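/- All Lie algebras are over $\mathbb{C}$. For $n=1,2,4$ let $A_n=\mathbb{C}\otimes_{\mathbb R}\mathbb{R},\ \mathbb{C}\otimes_{\mathbb R}\mathbb{C},\ \mathbb{C}\otimes_{\mathbb R}\mathbb{H}$, with its $\mathbb{C}$-linear conjugation and its real part $A_n\to\mathbb{C}$. For a $3\times3$ matrix $x$ over $A_n$ let $x^\dagger$ be its conjugate transpose (the transpose if $n=1$) and $t(x)\in\mathbb{C}$ the real part of its trace. Let $\mathbf{J}_3^n=\{x : x^\dagger=x\}$ (for $n=1$, the symmetric complex $3\times 3$ matrices), $t(x,y)=\frac12t(xy+yx)$, and $$x\# y=xy+yx-t(y)\,x-t(x)\,y-\bigl(t(x,y)-t(x)t(y)\bigr)I .$$ Let $\mathfrak{sl}_3(A_n)$ be the $3\times3$ matrices over $A_n$ whose trace is a sum of commutators of $A_n$; it is $\mathbf a_2,\ \mathbf a_2\oplus\mathbf a_2,\ \mathbf a_5$ for $n=1,2,4$. Let $M_n$ be the complex vector space of block matrices $$\begin{pmatrix} a\otimes I+I\otimes a_1 & \mathbf s^+\\ \mathbf s^- & -I\otimes a_1^\dagger\end{pmatrix},$$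 where $a$ is a traceless complex $3\times3$ matrix whose entries outside the positions $11,13,21,22,33$ vanish, $a_1\in\mathfrak{sl}_3(A_n)$, $\mathbf s^+=(s^+_1,s^+_2,0)^T$ and $\mathbf s^-=(s^-_1,0,s^-_3)$ with $s^\pm_i\in\mathbf J_3^n$. Define the bracket of the block matrices with data $(a,a_1,\mathbf s^\pm)$ and $(b,b_1,\mathbf r^\pm)$ to be the block matrix $\begin{pmatrix}C_{11}&C_{12}\\C_{21}&C_{22}\end{pmatrix}$ with $$\begin{aligned} C_{11}&=\bigl([a,b]-E_{22}[a,b]E_{33}\bigr)\otimes I+I\otimes[a_1,b_1]+\mathbf s^+\diamond\mathbf r^--\mathbf r^+\diamond\mathbf s^-,\\ (C_{12})_i&=\textstyle\sum_j(a_{ij}r^+_j-b_{ij}s^+_j)+a_1r^+_i+r^+_ia_1^\dagger-b_1s^+_i-s^+_ib_1^\dagger+(\mathbf s^-\times\mathbf r^-)_i,\\ (C_{21})_i&=\textstyle\sum_j(b_{ji}s^-_j-a_{ji}r^-_j)-a_1^\dagger r^-_i-r^-_ia_1+b_1^\dagger s^-_i+s^-_ib_1+(\mathbf s^+\times\mathbf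 r^+)_i,\\ C_{22}&=I\otimes[a_1^\dagger,b_1^\dagger]+\mathbf s^-\bullet\mathbf r^+-\mathbf r^-\bullet\mathbf s^+, \end{aligned}$$ where $E_{ij}$ are the matrix units, $(\mathbf s\times\mathbf r)_i=\sum_{j,k}\epsilon_{ijk}\,s_j\# r_k$ and $$\begin{aligned} \mathbf s^+\diamond\mathbf r^-&=\Bigl(\tfrac13t(s^+_1,r^-_1)I-\!\!\sum_{(i,j)\neq(2,3)}\!\!t(s^+_i,r^-_j)E_{ij}\Bigr)\otimes I+I\otimes\bigl(\tfrac13t(s^+_1,r^-_1)I-s^+_1r^-_1\bigr),\\ \mathbf s^-\bullet\mathbf r^+&=I\otimes\bigl(\tfrac13t(s^-_1,r^+_1)I-s^-_1r^+_1\bigr). \end{aligned}$$ Then, for $n=1$, this is a well-defined bilinear bracket on $M_1$ which makes $M_1$ a Lie algebra of dimension $36$, and $M_1$ is the image of a faithful representation $\varrho$ (a linear bijection onto $M_1$ that carries brackets to brackets) of the intermediate algebra $$\mathbf c_{3\frac12}=(\mathbf c_3\oplus\mathbb{C})\ltimes V_{14}.$$ Here $V_{14}$ is an irreducible $14$-dimensional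 $\mathbf c_3$-module with a nondegenerate skew-symmetric invariant form; in the semidirect product $V_{14}$ is an abelian ideal, and the singlet $\mathbb{C}$ commutes with $\mathbf c_3$ and acts on $V_{14}$ by scalars. In the same way, $M_2$ and $M_4$ are Lie algebras of dimensions $56$ and $99$, and they are the images of faithful representations of $$\mathbf a_{5\frac12}=(\mathbf a_5\oplus\mathbb{C})\ltimes V_{20}\qquad\text{and}\qquad \mathbf d_{6\frac12}=(\mathbf d_6\oplus\mathbb{C})\ltimes V_{32},$$ where $V_{20}$ and $V_{32}$ are irreducible modules of the indicated dimensions over $\mathbf a_5$ and $\mathbf d_6$, with nondegenerate skew-symmetric invariant forms. -/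

import Mathlib

open scoped Quaternion

noncomputable section

namespace IntermediateLie

/-! ### Coordinates: the complexified real, complex and quaternion algebras -/

/-- The conjugation and the real part (both `ℂ`-linear) of a complexified composition algebra. -/
structure Coordinates (A : Type) [Ring A] [Algebra ℂ A] where
  conj : A →ₗ[ℂ] A
  re : A →ₗ[ℂ] ℂ

/-- `n = 1`: the complexification of `ℝ`, that is `ℂ`, with trivial conjugation (the complex
conjugation of the ground field never enters). -/
def realCoordinates : Coordinates ℂ where
  conj := LinearMap.id
  re := LinearMap.id

/-- The complexification `ℂ ⊗ ℂ` of the complex numbers: elements `x + y u` with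
`x, y` in the ground field `ℂ` and `u ^ 2 = -1`. -/
abbrev BiComplex : Type := QuadraticAlgebra ℂ (-1) 0

/-- `n = 2`: conjugation `x + y u ↦ x - y u`. -/
def complexCoordinates : Coordinates BiComplex where
  conj :=
    { toFun := fun z => ⟨z.re, -z.im⟩
      map_add' := fun x y => by ext <;> simp [add_comm]
      map_smul' := fun c x => by ext <;> simp }
  re :=
    { toFun := fun z => z.re
      map_add' := fun x y => by simp
      map_smul' := fun c x => by simp }

/-- `n = 4`: quaternions with coefficients in `ℂ`; here `star` is the (`ℂ`-linear) quaternionic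
conjugation. -/
def quaternionCoordinates : Coordinates ℍ[ℂ] where
  conj :=
    { toFun := fun z => star z
      map_add' := fun x y => star_add x y
      map_smul' := fun c x => by ext <;> simp }
  re :=
    { toFun := fun z => z.re
      map_add' := fun x y => by simp
      map_smul' := fun c x => by simp }

/-! ### `3 × 3` matrices over the coordinates -/

/-- `3 × 3` matrices. -/
abbrev Mat3 (A : Type) : Type := Matrix (Fin 3) (Fin 3) A

/-- `9 × 9` matrices, viewed as elements of `M₃(ℂ) ⊗ M₃(A)`. -/
abbrev Mat9 (A : Type) : Type := Matrix (Fin 3 × Fin 3) (Fin 3 × Fin 3) A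

/-- The tensor product `a ⊗ x` (Kronecker product) of `a ∈ M₃(ℂ)` and `x ∈ M₃(A)`. -/
def tens {A : Type} [Ring A] [Algebra ℂ A] (a : Mat3 ℂ) (x : Mat3 A) : Mat9 A :=
  Matrix.kroneckerMap (fun c y => c • y) a x

/-- The simple Lie algebras (or sums of them) `a₂`, `a₂ ⊕ a₂`, `a₅` acting on the Jordan algebras,
realised as `sl₃(A)`: the `3 × 3` matrices over `A` whose trace is a sum of commutators.
For commutative `A` this means trace zero; for the quaternions it means that the trace has
real part zero, which is `sl₆(ℂ)` because `ℂ ⊗ ℍ` is the algebra of `2 × 2` matrices. -/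
def specialLinear3 (A : Type) [Ring A] [Algebra ℂ A] : Submodule ℂ (Mat3 A) :=
  (Submodule.span ℂ {c : A | ∃ x y : A, c = x * y - y * x}).comap
    (Matrix.traceLinearMap (Fin 3) ℂ A)

namespace Coordinates

variable {A : Type} [Ring A] [Algebra ℂ A] (C : Coordinates A)

/-- Conjugate transpose; for `n = 1` just the transpose. -/
def adj (x : Mat3 A) : Mat3 A := (x.map C.conj).transpose

/-- The Jordan algebra `J₃ⁿ` of Hermitian matrices; for `n = 1` the symmetric complex matrices. -/
def IsHerm (x : Mat3 A) : Prop := C.adj x = x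

/-- The (scalar) trace. -/
def tr (x : Mat3 A) : ℂ := C.re x.trace

/-- The Jordan product. -/
def jordan (x y : Mat3 A) : Mat3 A := (1 / 2 : ℂ) • (x * y + y * x)

/-- The trace form `t(x, y) = t(x · y)`. -/
def trForm (x y : Mat3 A) : ℂ := C.tr (jordan x y)

/-- The sharp product `x # y`. -/
def sharp (x y : Mat3 A) : Mat3 A :=
  x * y + y * x - C.tr y • x - C.tr x • y - (C.trForm x y - C.tr x * C.tr y) • (1 : Mat3 A)

/-- `(s × r)ᵢ = ∑ εᵢⱼₖ sⱼ # rₖ`, the sum being written out; indices are modulo `3`. -/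
def cross (s r : Fin 3 → Mat3 A) : Fin 3 → Mat3 A :=
  fun i => C.sharp (s (i + 1)) (r (i + 2)) - C.sharp (s (i + 2)) (r (i + 1))

/-- `s⁺ ⋄ r⁻`. Indices start at `0`, so `E₂₃` is the position `(1, 2)`. -/
def diamond (s r : Fin 3 → Mat3 A) : Mat9 A :=
  tens ((1 / 3 * C.trForm (s 0) (r 0)) • (1 : Mat3 ℂ)
      - Matrix.of fun i j => (1 - Matrix.single (1 : Fin 3) (2 : Fin 3) (1 : ℂ) i j)
          * C.trForm (s i) (r j)) 1
    + tens 1 ((1 / 3 * C.trForm (s 0) (r 0)) • (1 : Mat3 A) - s 0 * r 0)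

/-- `s⁻ • r⁺`. -/
def bullet (s r : Fin 3 → Mat3 A) : Mat9 A :=
  tens 1 ((1 / 3 * C.trForm (s 0) (r 0)) • (1 : Mat3 A) - s 0 * r 0)

end Coordinates

/-- The product `a b - E₂₂ a b E₃₃`. -/
def dotMul (a b : Mat3 ℂ) : Mat3 ℂ :=
  a * b - Matrix.single 1 1 1 * (a * b) * Matrix.single 2 2 1

/-! ### The block matrices -/

/-- Zorn type block matrices: the four blocks are listed in the order
upper left, upper right, lower left, lower right. -/
abbrev BlockMatrix (A : Type) : Type :=
  Mat9 A × (Fin 3 → Mat3 A) × (Fin 3 → Mat3 A) × Mat9 A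

/-- The data `a`, `a₁`, `s⁺`, `s⁻` from which a block matrix is built. -/
structure BlockData (A : Type) where
  a : Mat3 ℂ
  a₁ : Mat3 A
  sPlus : Fin 3 → Mat3 A
  sMinus : Fin 3 → Mat3 A

namespace Coordinates

variable {A : Type} [Ring A] [Algebra ℂ A] (C : Coordinates A)

/-- The constraints on the data: `a` is traceless with nonzero entries only at the positions
`11, 13, 21, 22, 33`; `a₁ ∈ sl₃(A)`; `s⁺ = (s⁺₁, s⁺₂, 0)` and `s⁻ = (s⁻₁, 0, s⁻₃)` have components
in the Jordan algebra. -/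
structure Admissible (X : BlockData A) : Prop where
  trace_a : X.a.trace = 0
  a_12 : X.a 0 1 = 0
  a_23 : X.a 1 2 = 0
  a_31 : X.a 2 0 = 0
  a_32 : X.a 2 1 = 0
  a₁_mem : X.a₁ ∈ specialLinear3 A
  sPlus_herm : ∀ i, C.IsHerm (X.sPlus i)
  sMinus_herm : ∀ i, C.IsHerm (X.sMinus i)
  sPlus_3 : X.sPlus 2 = 0
  sMinus_2 : X.sMinus 1 = 0

/-- The block matrix `(a ⊗ I + I ⊗ a₁, s⁺; s⁻, - I ⊗ a₁†)`. -/
def block (X : BlockData A) : BlockMatrix A :=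
  (tens X.a 1 + tens 1 X.a₁, X.sPlus, X.sMinus, -tens 1 (C.adj X.a₁))

lemma adj_zero : C.adj 0 = 0 := by
  ext; simp [adj]

lemma adj_add (x y : Mat3 A) : C.adj (x + y) = C.adj x + C.adj y := by
  ext; simp [adj]

lemma adj_smul (c : ℂ) (x : Mat3 A) : C.adj (c • x) = c • C.adj x := by
  ext; simp [adj]

lemma isHerm_add {x y : Mat3 A} (hx : C.IsHerm x) (hy : C.IsHerm y) : C.IsHerm (x + y) := by
  unfold IsHerm at *
  rw [adj_add, hx, hy]

lemma isHerm_smul (c : ℂ) {x : Mat3 A} (hx : C.IsHerm x) : C.IsHerm (c • x) := by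
  unfold IsHerm at *
  rw [adj_smul, hx]

/-- The complex vector space of all these block matrices. -/
def blockMatrices : Submodule ℂ (BlockMatrix A) where
  carrier := {B | ∃ X : BlockData A, C.Admissible X ∧ C.block X = B}
  zero_mem' := by
    refine ⟨⟨0, 0, 0, 0⟩, ⟨by simp, rfl, rfl, rfl, rfl, Submodule.zero_mem _, fun _ => C.adj_zero,
      fun _ => C.adj_zero, rfl, rfl⟩, Prod.ext ?_ (Prod.ext rfl (Prod.ext rfl ?_))⟩
    · ext; simp [block, tens]
    · ext; simp [block, tens, adj_zero]
  add_mem' := by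
    rintro _ _ ⟨X, hX, rfl⟩ ⟨Y, hY, rfl⟩
    refine ⟨⟨X.a + Y.a, X.a₁ + Y.a₁, X.sPlus + Y.sPlus, X.sMinus + Y.sMinus⟩,
      ⟨?_, ?_, ?_, ?_, ?_, Submodule.add_mem _ hX.a₁_mem hY.a₁_mem,
        fun i => C.isHerm_add (hX.sPlus_herm i) (hY.sPlus_herm i),
        fun i => C.isHerm_add (hX.sMinus_herm i) (hY.sMinus_herm i), ?_, ?_⟩,
      Prod.ext ?_ (Prod.ext rfl (Prod.ext rfl ?_))⟩
    · simp [hX.trace_a, hY.trace_a]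
    · simp [hX.a_12, hY.a_12]
    · simp [hX.a_23, hY.a_23]
    · simp [hX.a_31, hY.a_31]
    · simp [hX.a_32, hY.a_32]
    · simp [hX.sPlus_3, hY.sPlus_3]
    · simp [hX.sMinus_2, hY.sMinus_2]
    · ext; simp [block, tens, add_smul]; abel
    · ext; simp [block, tens, adj_add]; abel
  smul_mem' := by
    rintro c _ ⟨X, hX, rfl⟩
    refine ⟨⟨c • X.a, c • X.a₁, c • X.sPlus, c • X.sMinus⟩,
      ⟨?_, ?_, ?_, ?_, ?_, Submodule.smul_mem _ c hX.a₁_mem,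
        fun i => C.isHerm_smul c (hX.sPlus_herm i),
        fun i => C.isHerm_smul c (hX.sMinus_herm i), ?_, ?_⟩,
      Prod.ext ?_ (Prod.ext rfl (Prod.ext rfl ?_))⟩
    · simp [hX.trace_a]
    · simp [hX.a_12]
    · simp [hX.a_23]
    · simp [hX.a_31]
    · simp [hX.a_32]
    · simp [hX.sPlus_3]
    · simp [hX.sMinus_2]
    · ext; simp [block, tens, mul_smul, smul_comm c]
    · ext; simp [block, tens, adj_smul, smul_comm c]

/-- The block matrix built from admissible data, as an element of the space `blockMatrices`. -/
def toBlock (X : BlockData A) (hX : C.Admissible X) : C.blockMatrices :=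
  ⟨C.block X, X, hX, rfl⟩

/-- The block matrix `(C₁₁, C₁₂; C₂₁, C₂₂)` to which the commutator of the block matrices with
data `X = (a, a₁, s⁺, s⁻)` and `Y = (b, b₁, r⁺, r⁻)` is set equal. In `C₁₂` and `C₂₁` the factors
`a ⊗ I` multiply the column `r⁺` from the left and the row `r⁻` from the right, while
`I ⊗ a₁` acts on every component. -/
def blockBracket (X Y : BlockData A) : BlockMatrix A :=
  ( tens (dotMul X.a Y.a - dotMul Y.a X.a) 1 + tens 1 (X.a₁ * Y.a₁ - Y.a₁ * X.a₁)
      + C.diamond X.sPlus Y.sMinus - C.diamond Y.sPlus X.sMinus,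
    fun i =>
      (∑ j, X.a i j • Y.sPlus j) - (∑ j, Y.a i j • X.sPlus j)
        + X.a₁ * Y.sPlus i + Y.sPlus i * C.adj X.a₁
        - Y.a₁ * X.sPlus i - X.sPlus i * C.adj Y.a₁
        + C.cross X.sMinus Y.sMinus i,
    fun i =>
      -(∑ j, X.a j i • Y.sMinus j) + (∑ j, Y.a j i • X.sMinus j)
        - C.adj X.a₁ * Y.sMinus i - Y.sMinus i * X.a₁
        + C.adj Y.a₁ * X.sMinus i + X.sMinus i * Y.a₁
        + C.cross X.sPlus Y.sPlus i,
    tens 1 (C.adj X.a₁ * C.adj Y.a₁ - C.adj Y.a₁ * C.adj X.a₁)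
      + C.bullet X.sMinus Y.sPlus - C.bullet Y.sMinus X.sPlus )

end Coordinates

/-! ### The intermediate Lie algebras -/

/-- The underlying space of the semidirect product `(𝔥 ⊕ ℂ) ⋉ V`, for an `𝔥`-module `V`: triples
`(x, c, v)`. -/
def Intermediate (𝔥 V : Type) : Type := 𝔥 × ℂ × V

namespace Intermediate

variable (𝔥 V : Type) [LieRing 𝔥] [LieAlgebra ℂ 𝔥] [AddCommGroup V] [Module ℂ V]

instance : AddCommGroup (Intermediate 𝔥 V) := inferInstanceAs (AddCommGroup (𝔥 × ℂ × V))

instance : Module ℂ (Intermediate 𝔥 V) := inferInstanceAs (Module ℂ (𝔥 × ℂ × V))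

variable [LieRingModule 𝔥 V] [LieModule ℂ 𝔥 V]

/-- In `(𝔥 ⊕ ℂ) ⋉ V` the ideal `V` is abelian, `𝔥` acts on it by the given representation, and the
singlet `ℂ` commutes with `𝔥` and acts on `V` by scalars. -/
instance : Bracket (Intermediate 𝔥 V) (Intermediate 𝔥 V) where
  bracket p q :=
    ((⁅p.1, q.1⁆, 0, (⁅p.1, q.2.2⁆ + p.2.1 • q.2.2) - (⁅q.1, p.2.2⁆ + q.2.1 • p.2.2)) :
      𝔥 × ℂ × V)

instance : LieRing (Intermediate 𝔥 V) where
  add_lie := by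
    rintro ⟨x, c, v⟩ ⟨y, d, w⟩ ⟨z, e, u⟩
    refine Prod.ext ?_ (Prod.ext ?_ ?_)
    · exact add_lie x y z
    · exact (add_zero (0 : ℂ)).symm
    · change (⁅x + y, u⁆ + (c + d) • u) - (⁅z, v + w⁆ + e • (v + w)) =
        ((⁅x, u⁆ + c • u) - (⁅z, v⁆ + e • v)) + ((⁅y, u⁆ + d • u) - (⁅z, w⁆ + e • w))
      simp only [add_lie, lie_add, add_smul, smul_add]; abel
  lie_add := by
    rintro ⟨x, c, v⟩ ⟨y, d, w⟩ ⟨z, e, u⟩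
    refine Prod.ext ?_ (Prod.ext ?_ ?_)
    · exact lie_add x y z
    · exact (add_zero (0 : ℂ)).symm
    · change (⁅x, w + u⁆ + c • (w + u)) - (⁅y + z, v⁆ + (d + e) • v) =
        ((⁅x, w⁆ + c • w) - (⁅y, v⁆ + d • v)) + ((⁅x, u⁆ + c • u) - (⁅z, v⁆ + e • v))
      simp only [add_lie, lie_add, add_smul, smul_add]; abel
  lie_self := by
    rintro ⟨x, c, v⟩
    refine Prod.ext ?_ (Prod.ext rfl ?_)
    · exact lie_self x
    · exact sub_self (⁅x, v⁆ + c • v)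
  leibniz_lie := by
    rintro ⟨x, c, v⟩ ⟨y, d, w⟩ ⟨z, e, u⟩
    refine Prod.ext ?_ (Prod.ext ?_ ?_)
    · exact leibniz_lie x y z
    · exact (add_zero (0 : ℂ)).symm
    · change
        (⁅x, (⁅y, u⁆ + d • u) - (⁅z, w⁆ + e • w)⁆ + c • ((⁅y, u⁆ + d • u) - (⁅z, w⁆ + e • w)))
          - (⁅⁅y, z⁆, v⁆ + (0 : ℂ) • v) =
        ((⁅⁅x, y⁆, u⁆ + (0 : ℂ) • u)
          - (⁅z, (⁅x, w⁆ + c • w) - (⁅y, v⁆ + d • v)⁆ + e • ((⁅x, w⁆ + c • w) - (⁅y, v⁆ + d • v))))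
        + ((⁅y, (⁅x, u⁆ + c • u) - (⁅z, v⁆ + e • v)⁆ + d • ((⁅x, u⁆ + c • u) - (⁅z, v⁆ + e • v)))
          - (⁅⁅x, z⁆, w⁆ + (0 : ℂ) • w))
      simp only [lie_lie, lie_sub, lie_add, lie_smul, smul_sub, smul_add, zero_smul, smul_smul,
        mul_comm d c, mul_comm e c, mul_comm e d]
      abel

instance : LieAlgebra ℂ (Intermediate 𝔥 V) where
  lie_smul := by
    rintro r ⟨x, c, v⟩ ⟨y, d, w⟩
    refine Prod.ext ?_ (Prod.ext ?_ ?_)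
    · exact lie_smul r x y
    · exact (smul_zero r).symm
    · change (⁅x, r • w⁆ + c • (r • w)) - (⁅r • y, v⁆ + (r * d) • v) =
        r • ((⁅x, w⁆ + c • w) - (⁅y, v⁆ + d • v))
      simp only [lie_smul, smul_lie, smul_sub, smul_add, smul_smul, mul_comm r c]

end Intermediate

/-- The block matrices over the coordinates `C` form, with the bracket `blockBracket`, a complex
Lie algebra of dimension `d` which is the image of a faithful representation `ϱ` of the intermediate
algebra `(𝔥 ⊕ ℂ) ⋉ V`, where `V` is an irreducible symplectic (carrying a nondegenerate
skew-symmetric invariant form) representation of `𝔥` of dimension `m`. -/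
def Coordinates.RepresentsIntermediate {A : Type} [Ring A] [Algebra ℂ A] (C : Coordinates A)
    (𝔥 : Type) [LieRing 𝔥] [LieAlgebra ℂ 𝔥] (m d : ℕ) : Prop :=
  ∃ β : C.blockMatrices →ₗ[ℂ] C.blockMatrices →ₗ[ℂ] C.blockMatrices,
    -- the bracket is the one prescribed on block matrices
    (∀ (X Y : BlockData A) (hX : C.Admissible X) (hY : C.Admissible Y),
      (β (C.toBlock X hX) (C.toBlock Y hY) : BlockMatrix A) = C.blockBracket X Y) ∧
    -- it is a Lie bracket
    (∀ P, β P P = 0) ∧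
    (∀ P Q R, β P (β Q R) + β Q (β R P) + β R (β P Q) = 0) ∧
    Module.finrank ℂ C.blockMatrices = d ∧
    -- the Lie algebra is the intermediate algebra
    ∃ (V : Type) (_ : AddCommGroup V) (_ : Module ℂ V) (_ : LieRingModule 𝔥 V)
      (_ : LieModule ℂ 𝔥 V),
      Module.finrank ℂ V = m ∧
      LieModule.IsIrreducible ℂ 𝔥 V ∧
      (∃ ω : LinearMap.BilinForm ℂ V, ω.IsAlt ∧ ω.Nondegenerate ∧
        ∀ (x : 𝔥) (v w : V), ω ⁅x, v⁆ w + ω v ⁅x, w⁆ = 0) ∧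
      ∃ ϱ : Intermediate 𝔥 V ≃ₗ[ℂ] C.blockMatrices,
        ∀ p q : Intermediate 𝔥 V, ϱ ⁅p, q⁆ = β (ϱ p) (ϱ q)

end IntermediateLie

end

/-!
The three coordinate algebras `A` are associative composition algebras with nondegenerate trace
form (`Coordinates.IsComposition`), and nothing else about them is used until the very end. So the
Jordan algebra `J` of Hermitian `3 × 3` matrices sits in the associative algebra `M₃(A)`, which has
a cyclic trace. The one identity that needs matrix entries is the Cayley–Hamilton identity in `J`
(`cayley_hamilton`). Expanded into associative words, it says that the structure algebra acts on `J`
compatibly with the sharp product (`sharp_act`), and it computes `x # (y # z)` (`sharp_sharp`).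

The block matrices are graded by the weights of the diagonal of `a`. Here `s⁺₁`, `s⁻₁`, `a₁` and
one diagonal direction span a copy of the conformal algebra of `J`, which is the Lie algebra
`conformal` of the `6 × 6` matrices `(a, b; c, -a†)` over `A` with `b, c` Hermitian. The remaining
diagonal direction `diag(0, 1, -1)` is the singlet. It has eigenvalue `1` on the span of `E₂₁`,
`s⁺₂`, `s⁻₃`, `E₁₃`, which is the Freudenthal triple system `ℂ ⊕ J ⊕ J ⊕ ℂ`. The terms that are
left out at the position `E₂₃` are exactly the ones that would make it a Heisenberg algebra instead
of an abelian ideal.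

Therefore the Jacobi identity is not checked on block matrices. The two identities above make
`FreudenthalSpace` a Lie module over `conformal`, the semidirect product is a Lie algebra, and
`blockBracket_blockData` identifies its bracket with the prescribed one. The module is irreducible,
because raising operators carry any nonzero vector to the top degree and lowering operators carry
the top degree to everything (`eq_top_of_stable`). The dimensions follow from those of `A` and of
the conformal algebra.

It remains to recognise `conformal`. For `ℂ` it is literally `sp₆`. For `ℂ ⊗ ℂ = ℂ × ℂ` the
projection to the first factor is an isomorphism onto `sl₆`, since the second factor of an element
is determined by the first. For `ℂ ⊗ ℍ = M₂(ℂ)` the conjugate transpose is the transpose conjugated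
by the quaternion unit `j`, and conjugation by `diag(1, j)` leads to `so₁₂` in its split form.
-/

noncomputable section

namespace IntermediateLie

attribute [local instance 100] LieRing.ofAssociativeRing

/-! ### Coordinates that form a composition algebra -/

/-- The properties of the conjugation and of the real part that all three coordinate algebras share:
they make `A` an associative composition algebra with nondegenerate trace form. -/
structure Coordinates.IsComposition {A : Type} [Ring A] [Algebra ℂ A] (C : Coordinates A) :
    Prop where
  conj_mul : ∀ x y, C.conj (x * y) = C.conj y * C.conj x
  conj_conj : ∀ x, C.conj (C.conj x) = x
  add_conj : ∀ x, x + C.conj x = (2 * C.re x) • (1 : A)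
  re_one : C.re 1 = 1
  re_mul_comm : ∀ x y, C.re (x * y) = C.re (y * x)
  eq_zero_of_re : ∀ y, (∀ x, C.re (x * y) = 0) → y = 0

namespace Coordinates

variable {A : Type} [Ring A] [Algebra ℂ A] {C : Coordinates A}

/-! ### The trace -/

lemma tr_add (x y : Mat3 A) : C.tr (x + y) = C.tr x + C.tr y := by simp [tr]
lemma tr_sub (x y : Mat3 A) : C.tr (x - y) = C.tr x - C.tr y := by simp [tr]
lemma tr_neg (x : Mat3 A) : C.tr (-x) = -C.tr x := by simp [tr]
lemma tr_smul (c : ℂ) (x : Mat3 A) : C.tr (c • x) = c * C.tr x := by simp [tr]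
lemma tr_zero : C.tr (0 : Mat3 A) = 0 := by simp [tr]

lemma adj_sub (x y : Mat3 A) : C.adj (x - y) = C.adj x - C.adj y := by
  ext; simp [adj]
lemma adj_neg (x : Mat3 A) : C.adj (-x) = -C.adj x := by
  ext; simp [adj]

namespace IsComposition

variable (hC : C.IsComposition)
include hC

lemma conj_one : C.conj 1 = 1 := by
  have h := hC.conj_mul (C.conj 1) 1
  rw [mul_one, hC.conj_conj, mul_one] at h
  exact h.symm

lemma re_conj (x : A) : C.re (C.conj x) = C.re x := by
  have h := congrArg C.re (hC.add_conj x)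
  simp only [map_add, map_smul, hC.re_one, smul_eq_mul, mul_one] at h
  linear_combination h

lemma tr_one : C.tr (1 : Mat3 A) = 3 := by
  have h : (3 : A) = (3 : ℂ) • (1 : A) := by
    rw [← Algebra.algebraMap_eq_smul_one, map_ofNat]
  simp [tr, h, hC.re_one]

lemma tr_mul_comm (x y : Mat3 A) : C.tr (x * y) = C.tr (y * x) := by
  simp only [tr, Matrix.trace, Matrix.diag, Matrix.mul_apply, map_sum]
  rw [Finset.sum_comm]
  simp only [hC.re_mul_comm]

lemma tr_adj (x : Mat3 A) : C.tr (C.adj x) = C.tr x := by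
  simp [tr, adj, Matrix.trace, hC.re_conj]

lemma adj_adj (x : Mat3 A) : C.adj (C.adj x) = x := by
  ext; simp [adj, hC.conj_conj]

lemma adj_mul (x y : Mat3 A) : C.adj (x * y) = C.adj y * C.adj x := by
  ext; simp [adj, Matrix.mul_apply, hC.conj_mul]

lemma adj_one : C.adj 1 = 1 := by
  ext i j
  by_cases h : i = j
  · subst h; simp [adj, hC.conj_one]
  · simp [adj, Matrix.one_apply_ne h, Matrix.one_apply_ne (Ne.symm h)]

lemma trForm_eq (x y : Mat3 A) : C.trForm x y = C.tr (x * y) := by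
  rw [trForm, jordan, tr_smul, tr_add, hC.tr_mul_comm y x]
  ring

lemma sharp_eq (x y : Mat3 A) : C.sharp x y =
    x * y + y * x - C.tr y • x - C.tr x • y - (C.tr (x * y) - C.tr x * C.tr y) • 1 := by
  rw [sharp, hC.trForm_eq]

lemma sharp_comm (x y : Mat3 A) : C.sharp x y = C.sharp y x := by
  rw [hC.sharp_eq, hC.sharp_eq, hC.tr_mul_comm x y]
  module

lemma isHerm_one : C.IsHerm 1 := hC.adj_one

lemma isHerm_add_adj (x : Mat3 A) : C.IsHerm (x + C.adj x) := by
  rw [IsHerm, adj_add, hC.adj_adj, add_comm]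

lemma isHerm_sharp {x y : Mat3 A} (hx : C.IsHerm x) (hy : C.IsHerm y) : C.IsHerm (C.sharp x y) := by
  unfold IsHerm at *
  simp only [hC.sharp_eq, adj_sub, adj_add, adj_smul, hC.adj_mul, hx, hy, hC.adj_one]
  module

lemma isHerm_act (a : Mat3 A) {x : Mat3 A} (hx : C.IsHerm x) :
    C.IsHerm (a * x + x * C.adj a) := by
  unfold IsHerm at *
  rw [adj_add, hC.adj_mul, hC.adj_mul, hx, hC.adj_adj, add_comm]

/-! ### The Cayley–Hamilton identity -/

/-- The product of an element and its conjugate is a scalar, the norm. -/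
lemma mul_conj (x : A) : x * C.conj x = C.re (x * C.conj x) • 1 := by
  have h := hC.add_conj (x * C.conj x)
  rw [hC.conj_mul, hC.conj_conj, ← two_smul ℂ, mul_smul] at h
  exact (smul_right_injective A (two_ne_zero (α := ℂ))) h

lemma conj_mul_self (x : A) : C.conj x * x = C.re (x * C.conj x) • 1 := by
  have h := hC.mul_conj (C.conj x)
  rwa [hC.conj_conj, hC.re_mul_comm] at h

lemma eq_smul_one_of_conj {x : A} (hx : C.conj x = x) : x = C.re x • 1 := by
  have h := hC.add_conj x
  rw [hx, ← two_smul ℂ, mul_smul] at h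
  exact (smul_right_injective A (two_ne_zero (α := ℂ))) h

/-- The entries of a Hermitian matrix. -/
lemma exists_entries {x : Mat3 A} (hx : C.IsHerm x) : ∃ (α β γ : ℂ) (a b c : A),
    x = !![α • 1, c, C.conj b; C.conj c, β • 1, a; b, C.conj a, γ • 1] := by
  have h : ∀ i j, C.conj (x i j) = x j i := fun i j => congrFun (congrFun hx j) i
  refine ⟨C.re (x 0 0), C.re (x 1 1), C.re (x 2 2), x 1 2, x 2 0, x 0 1, ?_⟩
  ext i j
  fin_cases i <;> fin_cases j <;> simp [h]
  all_goals exact hC.eq_smul_one_of_conj (h _ _)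

/-- A Hermitian matrix multiplied by its adjugate (half of its sharp square) is scalar. -/
lemma exists_mul_adjugate {x : Mat3 A} (hx : C.IsHerm x) :
    ∃ N : ℂ, x * ((1 / 2 : ℂ) • C.sharp x x) = N • 1 := by
  obtain ⟨α, β, γ, a, b, c, rfl⟩ := hC.exists_entries hx
  set p := C.re (a * C.conj a)
  set q := C.re (b * C.conj b)
  set r := C.re (c * C.conj c)
  have ha1 : a * C.conj a = p • 1 := hC.mul_conj a
  have ha2 : C.conj a * a = p • 1 := hC.conj_mul_self a
  have hb1 : b * C.conj b = q • 1 := hC.mul_conj b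
  have hb2 : C.conj b * b = q • 1 := hC.conj_mul_self b
  have hc1 : c * C.conj c = r • 1 := hC.mul_conj c
  have hc2 : C.conj c * c = r • 1 := hC.conj_mul_self c
  have key : (1 / 2 : ℂ) • C.sharp !![α • 1, c, C.conj b; C.conj c, β • 1, a; b, C.conj a, γ • 1]
      !![α • 1, c, C.conj b; C.conj c, β • 1, a; b, C.conj a, γ • 1] =
      !![(β * γ - p) • 1, C.conj b * C.conj a - γ • c, c * a - β • C.conj b;
        a * b - γ • C.conj c, (γ * α - q) • 1, C.conj c * C.conj b - α • a;
        C.conj a * C.conj c - β • b, b * c - α • C.conj a, (α * β - r) • 1] := by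
    rw [hC.sharp_eq]
    ext i j
    fin_cases i <;> fin_cases j <;>
    simp [tr, Matrix.trace, Fin.sum_univ_three, hC.re_one, ha1, ha2, hb1, hb2, hc1, hc2] <;> module
  rw [key]
  refine ⟨α * β * γ - α * p - β * q - γ * r + 2 * C.re (a * b * c), ?_⟩
  -- `a b c` and its cyclic permutations enter the diagonal with their conjugates
  have t1 := hC.add_conj (a * b * c)
  have t2 := hC.add_conj (b * (c * a))
  have t3 := hC.add_conj (c * a * b)
  have r3 : C.re (c * a * b) = C.re (a * b * c) := by
    rw [mul_assoc, hC.re_mul_comm]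
  have r2 : C.re (b * (c * a)) = C.re (a * b * c) := by
    rw [hC.re_mul_comm, r3]
  rw [r3] at t3
  rw [r2] at t2
  simp only [hC.conj_mul, ← mul_assoc] at t1 t2 t3
  have ka1 (u : A) : u * a * C.conj a = p • u := by simp [mul_assoc, ha1]
  have ka2 (u : A) : u * C.conj a * a = p • u := by simp [mul_assoc, ha2]
  have kb1 (u : A) : u * b * C.conj b = q • u := by simp [mul_assoc, hb1]
  have kb2 (u : A) : u * C.conj b * b = q • u := by simp [mul_assoc, hb2]
  have kc1 (u : A) : u * c * C.conj c = r • u := by simp [mul_assoc, hc1]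
  have kc2 (u : A) : u * C.conj c * c = r • u := by simp [mul_assoc, hc2]
  ext i j
  fin_cases i <;> fin_cases j <;>
  simp [Fin.sum_univ_three, Matrix.mul_apply, ha1, ha2, hb1, hb2, hc1, hc2, mul_sub, ← mul_assoc]
  · linear_combination (norm := module) t3
  · module
  · module
  · module
  · linear_combination (norm := module) t1
  · module
  · module
  · module
  · linear_combination (norm := module) t2

lemma sharp_add_left (x y z : Mat3 A) : C.sharp (x + y) z = C.sharp x z + C.sharp y z := by
  simp only [hC.sharp_eq, mul_add, add_mul, tr_add]
  module

lemma sharp_add_right (x y z : Mat3 A) : C.sharp x (y + z) = C.sharp x y + C.sharp x z := by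
  simp only [hC.sharp_eq, mul_add, add_mul, tr_add]
  module

lemma sharp_smul_left (c : ℂ) (x y : Mat3 A) : C.sharp (c • x) y = c • C.sharp x y := by
  simp only [hC.sharp_eq, smul_mul_assoc, mul_smul_comm, tr_smul]
  module

lemma sharp_smul_right (c : ℂ) (x y : Mat3 A) : C.sharp x (c • y) = c • C.sharp x y := by
  rw [hC.sharp_comm, hC.sharp_smul_left, hC.sharp_comm]

lemma sharp_neg_left (x y : Mat3 A) : C.sharp (-x) y = -C.sharp x y := by
  rw [← neg_one_smul ℂ x, hC.sharp_smul_left, neg_one_smul]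

lemma sharp_neg_right (x y : Mat3 A) : C.sharp x (-y) = -C.sharp x y := by
  rw [hC.sharp_comm, hC.sharp_neg_left, hC.sharp_comm]

lemma sharp_sub_left (x y z : Mat3 A) : C.sharp (x - y) z = C.sharp x z - C.sharp y z := by
  rw [sub_eq_add_neg, hC.sharp_add_left, hC.sharp_neg_left, sub_eq_add_neg]

lemma sharp_sub_right (x y z : Mat3 A) : C.sharp x (y - z) = C.sharp x y - C.sharp x z := by
  rw [hC.sharp_comm, hC.sharp_sub_left, hC.sharp_comm y, hC.sharp_comm z]

lemma zero_sharp (x : Mat3 A) : C.sharp 0 x = 0 := by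
  simpa using hC.sharp_smul_left 0 0 x

lemma sharp_zero (x : Mat3 A) : C.sharp x 0 = 0 := by
  rw [hC.sharp_comm, hC.zero_sharp]

/-- The cubic form `t(x, y # z)` is symmetric. -/
lemma tr_mul_sharp_left (x y z : Mat3 A) : C.tr (x * C.sharp y z) = C.tr (y * C.sharp x z) := by
  have e1 : C.tr (x * (z * y)) = C.tr (y * (x * z)) := by
    rw [← mul_assoc, hC.tr_mul_comm]
  have e2 : C.tr (x * (y * z)) = C.tr (y * (z * x)) := by
    rw [hC.tr_mul_comm, mul_assoc]
  simp only [hC.sharp_eq, mul_add, mul_sub, mul_smul_comm, mul_one, tr_add, tr_sub, tr_smul, e1, e2,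
    hC.tr_mul_comm x y]
  ring

/-- The polarised Cayley–Hamilton identity of the Jordan algebra of Hermitian matrices. Everything
that is needed about the sharp product is a formal consequence of it and of the cyclicity of the
trace. -/
lemma cayley_hamilton {x y z : Mat3 A} (hx : C.IsHerm x) (hy : C.IsHerm y) (hz : C.IsHerm z) :
    x * (C.sharp y z) + y * (C.sharp z x) + z * (C.sharp x y) = C.tr (x * C.sharp y z) • 1 := by
  -- every Hermitian matrix satisfies its characteristic equation
  have cubic : ∀ w, C.IsHerm w → w * C.sharp w w = ((1 / 3) * C.tr (w * C.sharp w w)) • 1 := by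
    intro w hw
    obtain ⟨N, hN⟩ := hC.exists_mul_adjugate hw
    have h2 : w * C.sharp w w = (2 * N) • 1 := by
      rw [mul_smul, ← hN, mul_smul_comm, smul_smul]; norm_num
    rw [h2, tr_smul, hC.tr_one]
    congr 1; ring
  -- the trilinear part of the cubic identity
  have e1 := cubic _ (C.isHerm_add (C.isHerm_add hx hy) hz)
  have e2 := cubic _ (C.isHerm_add hx hy)
  have e3 := cubic _ (C.isHerm_add hy hz)
  have e4 := cubic _ (C.isHerm_add hx hz)
  have e5 := cubic _ hx
  have e6 := cubic _ hy
  have e7 := cubic _ hz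
  simp only [hC.sharp_add_left, hC.sharp_add_right, mul_add, add_mul, tr_add,
    hC.sharp_comm y x, hC.sharp_comm z x, hC.sharp_comm z y, hC.tr_mul_sharp_left y x z,
    hC.tr_mul_sharp_left z x y] at e1 e2 e3 e4 e5 e6 e7 ⊢
  linear_combination (norm := module) (1 / 2 : ℂ) • (e1 - e2 - e3 - e4 + e5 + e6 + e7)

/-! ### Consequences for the sharp product -/

/-- The structure algebra acts on the Jordan algebra compatibly with the sharp product. In
associative words, this is the Cayley–Hamilton identity for `a + a†`, `x`, `y`; the skew part of `a`
acts by a derivation of the whole matrix algebra. -/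
lemma sharp_act (a : Mat3 A) {x y : Mat3 A} (hx : C.IsHerm x) (hy : C.IsHerm y) :
    C.sharp (a * x + x * C.adj a) y + C.sharp x (a * y + y * C.adj a) =
      (2 * C.tr a) • C.sharp x y - (C.adj a * C.sharp x y + C.sharp x y * a) := by
  have h := hC.cayley_hamilton (hC.isHerm_add_adj a) hx hy
  have ha := hC.tr_adj a
  set b := C.adj a
  have e1 : C.tr (x * (a * y)) = C.tr (a * (y * x)) := by
    rw [hC.tr_mul_comm, mul_assoc]
  have e2 : C.tr (x * (y * b)) = C.tr (b * (x * y)) := by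
    rw [← mul_assoc, hC.tr_mul_comm]
  have e3 : C.tr (x * (b * y)) = C.tr (b * (y * x)) := by
    rw [hC.tr_mul_comm, mul_assoc]
  have e4 := hC.tr_mul_comm x b
  have e5 := hC.tr_mul_comm y a
  have e6 := hC.tr_mul_comm y b
  simp only [hC.sharp_eq, mul_add, add_mul, mul_sub, sub_mul, smul_mul_assoc, mul_smul_comm,
    mul_one, one_mul, tr_add, tr_sub, tr_smul, mul_assoc, e1, e2, e3, e4, e5, e6, ha] at h ⊢
  linear_combination (norm := module) h

/-- Repeated sharp products are expressed through the associative product. -/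
lemma sharp_sharp {x y z : Mat3 A} (hx : C.IsHerm x) (hy : C.IsHerm y) (hz : C.IsHerm z) :
    C.sharp x (C.sharp y z) = C.tr (x * z) • y + C.tr (x * y) • z - (y * x * z + z * x * y) := by
  have h := hC.cayley_hamilton hx hy hz
  have e1 := hC.tr_mul_comm z y
  have e2 := hC.tr_mul_comm z x
  simp only [hC.sharp_eq, mul_add, add_mul, mul_sub, sub_mul, smul_mul_assoc, mul_smul_comm,
    mul_one, one_mul, tr_add, tr_sub, tr_smul, mul_assoc, e1, e2,
    hC.tr_one] at h ⊢
  linear_combination (norm := module) h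

/-- The sharp product with the identity. -/
lemma sharp_one (x : Mat3 A) : C.sharp 1 x = C.tr x • 1 - x := by
  rw [hC.sharp_eq, hC.tr_one, one_mul, mul_one]
  module

/-- Sharp multiplication by the identity is onto the Jordan algebra. -/
lemma exists_sharp_one {y : Mat3 A} (hy : C.IsHerm y) : ∃ x, C.IsHerm x ∧ C.sharp 1 x = y := by
  refine ⟨(1 / 2 * C.tr y) • 1 - y, ?_, ?_⟩
  · have h := C.isHerm_add (C.isHerm_smul (1 / 2 * C.tr y) hC.isHerm_one) (C.isHerm_smul (-1) hy)
    rwa [neg_one_smul, ← sub_eq_add_neg] at h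
  · rw [hC.sharp_one, tr_sub, tr_smul, hC.tr_one]
    module

/-- The trace form is nondegenerate on the Jordan algebra. -/
lemma eq_zero_of_tr_mul {y : Mat3 A} (hy : C.IsHerm y)
    (h : ∀ x, C.IsHerm x → C.tr (x * y) = 0) : y = 0 := by
  have h' : ∀ x, C.tr (x * y) = 0 := by
    intro x
    have h1 := h _ (hC.isHerm_add_adj x)
    have h2 : C.tr (C.adj x * y) = C.tr (x * y) := by
      rw [← hC.tr_adj, hC.adj_mul, hC.adj_adj, hy, hC.tr_mul_comm]
    rw [add_mul, tr_add, h2] at h1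
    linear_combination h1 / 2
  ext i j
  refine hC.eq_zero_of_re _ fun a => ?_
  have h1 := h' (Matrix.single j i a)
  rw [tr, Matrix.trace_single_mul] at h1
  exact h1

end IsComposition
end Coordinates

namespace Coordinates

variable {A : Type} [Ring A] [Algebra ℂ A] (C : Coordinates A)

/-! ### The conformal algebra -/

/-- The Jordan algebra of Hermitian matrices. -/
def hermitian : Submodule ℂ (Mat3 A) where
  carrier := {x | C.IsHerm x}
  zero_mem' := C.adj_zero
  add_mem' := C.isHerm_add
  smul_mem' c _ := C.isHerm_smul c

/-- The `3 × 3` matrices whose trace is a scalar modulo sums of commutators: the structure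
algebra `ℂ ⊕ sl₃(A)` of the Jordan algebra. -/
def structureAlgebra : Submodule ℂ (Mat3 A) where
  carrier := {a | a - (1 / 3 * C.tr a) • 1 ∈ specialLinear3 A}
  zero_mem' := by simp [tr_zero]
  add_mem' {a b} ha hb := by
    have h := (specialLinear3 A).add_mem ha hb
    have e : a + b - (1 / 3 * C.tr (a + b)) • (1 : Mat3 A) =
        a - (1 / 3 * C.tr a) • 1 + (b - (1 / 3 * C.tr b) • 1) := by
      rw [tr_add]; module
    rwa [← e] at h
  smul_mem' c a ha := by
    have h := (specialLinear3 A).smul_mem c ha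
    have e : c • a - (1 / 3 * C.tr (c • a)) • (1 : Mat3 A) =
        c • (a - (1 / 3 * C.tr a) • 1) := by
      rw [tr_smul]; module
    rwa [← e] at h

lemma mem_structureAlgebra {a : Mat3 A} :
    a ∈ C.structureAlgebra ↔ a - (1 / 3 * C.tr a) • 1 ∈ specialLinear3 A := Iff.rfl

namespace IsComposition

variable {C} (hC : C.IsComposition)
include hC

lemma re_eq_zero_of_mem_commutators {z : A}
    (hz : z ∈ Submodule.span ℂ {c : A | ∃ x y : A, c = x * y - y * x}) : C.re z = 0 := by
  induction hz using Submodule.span_induction with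
  | mem z hz =>
    obtain ⟨x, y, rfl⟩ := hz
    rw [map_sub, hC.re_mul_comm, sub_self]
  | zero => simp
  | add x y _ _ hx hy => rw [map_add, hx, hy, add_zero]
  | smul c x _ hx => rw [map_smul, hx, smul_zero]

lemma tr_eq_zero {a : Mat3 A} (ha : a ∈ specialLinear3 A) : C.tr a = 0 :=
  hC.re_eq_zero_of_mem_commutators ha

omit hC in
lemma trace_mul_sub_mem (x y : Mat3 A) : x * y - y * x ∈ specialLinear3 A := by
  rw [specialLinear3, Submodule.mem_comap, Matrix.traceLinearMap_apply]
  have e : (x * y - y * x).trace = ∑ i, ∑ j, (x i j * y j i - y j i * x i j) := by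
    rw [Matrix.trace_sub]
    simp only [Matrix.trace, Matrix.diag, Finset.sum_sub_distrib]
    simp only [Matrix.mul_apply]
    congr 1
    exact Finset.sum_comm
  rw [e]
  exact Submodule.sum_mem _ fun i _ => Submodule.sum_mem _ fun j _ =>
    Submodule.subset_span ⟨_, _, rfl⟩

lemma commutator_mem (x y : Mat3 A) : x * y - y * x ∈ C.structureAlgebra := by
  rw [mem_structureAlgebra, tr_sub, hC.tr_mul_comm, sub_self, mul_zero, zero_smul, sub_zero]
  exact trace_mul_sub_mem x y

lemma mul_mem {x y : Mat3 A} (hx : C.IsHerm x) (hy : C.IsHerm y) :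
    x * y ∈ C.structureAlgebra := by
  -- `x y` is its symmetric part, whose trace is a scalar, plus half of a commutator
  have e : x * y - (1 / 3 * C.tr (x * y)) • (1 : Mat3 A) =
      ((1 / 2 : ℂ) • (x * y + y * x) - (1 / 3 * C.tr (x * y)) • (1 : Mat3 A)) +
        (1 / 2 : ℂ) • (x * y - y * x) := by
    module
  rw [mem_structureAlgebra, e]
  refine Submodule.add_mem _ ?_ (Submodule.smul_mem _ _ (trace_mul_sub_mem x y))
  rw [specialLinear3, Submodule.mem_comap, Matrix.traceLinearMap_apply]
  have h1 : C.conj (x * y + y * x).trace = (x * y + y * x).trace := by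
    have h : C.adj (x * y + y * x) = x * y + y * x := by
      rw [adj_add, hC.adj_mul, hC.adj_mul, hx, hy, add_comm]
    have h' := congrArg Matrix.trace h
    simpa [adj, Matrix.trace] using h'
  have h2 : (x * y + y * x).trace = (2 * C.tr (x * y)) • (1 : A) := by
    rw [hC.eq_smul_one_of_conj h1]
    change C.tr (x * y + y * x) • (1 : A) = _
    rw [tr_add, hC.tr_mul_comm y x, two_mul]
  have h3 : (3 : A) = (3 : ℂ) • (1 : A) := by
    rw [← Algebra.algebraMap_eq_smul_one, map_ofNat]
  have h4 : ((1 / 2 : ℂ) • (x * y + y * x) - (1 / 3 * C.tr (x * y)) • (1 : Mat3 A)).trace = 0 := by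
    rw [Matrix.trace_sub, Matrix.trace_smul, Matrix.trace_smul, h2, Matrix.trace_one,
      Fintype.card_fin, Nat.cast_ofNat, h3]
    module
  rw [h4]
  exact Submodule.zero_mem _

omit hC in
lemma isHerm_sub {x y : Mat3 A} (hx : C.IsHerm x) (hy : C.IsHerm y) : C.IsHerm (x - y) :=
  C.hermitian.sub_mem hx hy

end IsComposition

variable {C}

/-- The conformal algebra of the Jordan algebra: the unitary Lie algebra over `A` of the split
skew-Hermitian form on `A⁶`, restricted by a condition on the trace. It is `c₃`, `a₅`, `d₆` in the
three cases. -/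
def conformal (hC : C.IsComposition) :
    LieSubalgebra ℂ (Matrix (Fin 3 ⊕ Fin 3) (Fin 3 ⊕ Fin 3) A) where
  carrier := {X | ∃ a b c, a ∈ C.structureAlgebra ∧ C.IsHerm b ∧ C.IsHerm c ∧
    X = Matrix.fromBlocks a b c (-C.adj a)}
  zero_mem' := ⟨0, 0, 0, zero_mem _, C.adj_zero, C.adj_zero, by simp [adj_zero]⟩
  add_mem' := by
    rintro _ _ ⟨a, b, c, ha, hb, hc, rfl⟩ ⟨a', b', c', ha', hb', hc', rfl⟩
    refine ⟨_, _, _, add_mem ha ha', C.isHerm_add hb hb', C.isHerm_add hc hc', ?_⟩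
    rw [Matrix.fromBlocks_add, adj_add, neg_add]
  smul_mem' := by
    rintro k _ ⟨a, b, c, ha, hb, hc, rfl⟩
    refine ⟨_, _, _, Submodule.smul_mem _ k ha, C.isHerm_smul k hb, C.isHerm_smul k hc, ?_⟩
    rw [Matrix.fromBlocks_smul, adj_smul, smul_neg]
  lie_mem' := by
    rintro _ _ ⟨a, b, c, ha, hb, hc, rfl⟩ ⟨a', b', c', ha', hb', hc', rfl⟩
    refine ⟨(a * a' - a' * a) + (b * c' - b' * c),
      (a * b' + b' * C.adj a) - (a' * b + b * C.adj a'),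
      (C.adj a' * c + c * C.adj (C.adj a')) - (C.adj a * c' + c' * C.adj (C.adj a)), ?_, ?_, ?_, ?_⟩
    · exact add_mem (hC.commutator_mem a a') (sub_mem (hC.mul_mem hb hc') (hC.mul_mem hb' hc))
    · exact IsComposition.isHerm_sub (hC.isHerm_act a hb') (hC.isHerm_act a' hb)
    · exact IsComposition.isHerm_sub (hC.isHerm_act _ hc) (hC.isHerm_act _ hc')
    · rw [LieRing.of_associative_ring_bracket, Matrix.fromBlocks_multiply,
        Matrix.fromBlocks_multiply, sub_eq_add_neg, Matrix.fromBlocks_neg, Matrix.fromBlocks_add]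
      simp only [adj_sub, adj_add, hC.adj_mul, hC.adj_adj, show C.adj b = b from hb,
        show C.adj c = c from hc, show C.adj b' = b' from hb', show C.adj c' = c' from hc']
      congr 1 <;> noncomm_ring

namespace conformal

variable {hC : C.IsComposition}

/-- The upper left block. -/
def ul (X : C.conformal hC) : Mat3 A := X.1.toBlocks₁₁

/-- The upper right block. -/
def ur (X : C.conformal hC) : Mat3 A := X.1.toBlocks₁₂

/-- The lower left block. -/
def ll (X : C.conformal hC) : Mat3 A := X.1.toBlocks₂₁

lemma ul_mem (X : C.conformal hC) : ul X ∈ C.structureAlgebra := by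
  obtain ⟨_, a, b, c, ha, hb, hc, rfl⟩ := X
  exact ha

lemma ur_herm (X : C.conformal hC) : C.IsHerm (ur X) := by
  obtain ⟨_, a, b, c, ha, hb, hc, rfl⟩ := X
  exact hb

lemma ll_herm (X : C.conformal hC) : C.IsHerm (ll X) := by
  obtain ⟨_, a, b, c, ha, hb, hc, rfl⟩ := X
  exact hc

lemma coe_eq (X : C.conformal hC) :
    (X : Matrix (Fin 3 ⊕ Fin 3) (Fin 3 ⊕ Fin 3) A) =
      Matrix.fromBlocks (ul X) (ur X) (ll X) (-C.adj (ul X)) := by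
  obtain ⟨_, a, b, c, ha, hb, hc, rfl⟩ := X
  rfl

/-- The element with given blocks. -/
def mk (hC : C.IsComposition) (a b c : Mat3 A) (ha : a ∈ C.structureAlgebra) (hb : C.IsHerm b)
    (hc : C.IsHerm c) : C.conformal hC :=
  ⟨Matrix.fromBlocks a b c (-C.adj a), a, b, c, ha, hb, hc, rfl⟩

lemma ext {X Y : C.conformal hC} (h1 : ul X = ul Y) (h2 : ur X = ur Y) (h3 : ll X = ll Y) :
    X = Y := by
  rw [Subtype.ext_iff, coe_eq, coe_eq Y, h1, h2, h3]

lemma ul_add (X Y : C.conformal hC) : ul (X + Y) = ul X + ul Y := rfl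
lemma ur_add (X Y : C.conformal hC) : ur (X + Y) = ur X + ur Y := rfl
lemma ll_add (X Y : C.conformal hC) : ll (X + Y) = ll X + ll Y := rfl
lemma ul_smul (k : ℂ) (X : C.conformal hC) : ul (k • X) = k • ul X := rfl
lemma ur_smul (k : ℂ) (X : C.conformal hC) : ur (k • X) = k • ur X := rfl
lemma ll_smul (k : ℂ) (X : C.conformal hC) : ll (k • X) = k • ll X := rfl

lemma coe_lie (X Y : C.conformal hC) :
    (⁅X, Y⁆ : C.conformal hC).1 = Matrix.fromBlocks
      (ul X * ul Y - ul Y * ul X + (ur X * ll Y - ur Y * ll X))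
      (ul X * ur Y + ur Y * C.adj (ul X) - (ul Y * ur X + ur X * C.adj (ul Y)))
      (C.adj (ul Y) * ll X + ll X * ul Y - (C.adj (ul X) * ll Y + ll Y * ul X))
      (ll X * ur Y + C.adj (ul X) * C.adj (ul Y)
        - (ll Y * ur X + C.adj (ul Y) * C.adj (ul X))) := by
  change X.1 * Y.1 - Y.1 * X.1 = _
  rw [coe_eq, coe_eq Y, Matrix.fromBlocks_multiply, Matrix.fromBlocks_multiply, sub_eq_add_neg,
    Matrix.fromBlocks_neg, Matrix.fromBlocks_add]
  congr 1 <;> noncomm_ring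

lemma ul_lie (X Y : C.conformal hC) :
    ul ⁅X, Y⁆ = ul X * ul Y - ul Y * ul X + (ur X * ll Y - ur Y * ll X) := by
  rw [ul, coe_lie, Matrix.toBlocks_fromBlocks₁₁]

lemma ur_lie (X Y : C.conformal hC) :
    ur ⁅X, Y⁆ = ul X * ur Y + ur Y * C.adj (ul X) - (ul Y * ur X + ur X * C.adj (ul Y)) := by
  rw [ur, coe_lie, Matrix.toBlocks_fromBlocks₁₂]

lemma ll_lie (X Y : C.conformal hC) :
    ll ⁅X, Y⁆ = C.adj (ul Y) * ll X + ll X * ul Y - (C.adj (ul X) * ll Y + ll Y * ul X) := by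
  rw [ll, coe_lie, Matrix.toBlocks_fromBlocks₂₁]

end conformal

end Coordinates

namespace Coordinates

variable {A : Type} [Ring A] [Algebra ℂ A] {C : Coordinates A}

/-! ### The Freudenthal triple system as a module over the conformal algebra -/

variable (C) in
/-- The space of the Freudenthal triple system: two scalars and two Hermitian matrices. -/
def FreudenthalSpace : Type := ℂ × C.hermitian × C.hermitian × ℂ

namespace FreudenthalSpace

instance : AddCommGroup C.FreudenthalSpace :=
  inferInstanceAs (AddCommGroup (ℂ × C.hermitian × C.hermitian × ℂ))

instance : Module ℂ C.FreudenthalSpace :=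
  inferInstanceAs (Module ℂ (ℂ × C.hermitian × C.hermitian × ℂ))

/-- The scalar component of lowest degree. -/
def bot (v : C.FreudenthalSpace) : ℂ := v.1

/-- The Hermitian component of lower degree. -/
def low (v : C.FreudenthalSpace) : Mat3 A := v.2.1

/-- The Hermitian component of higher degree. -/
def high (v : C.FreudenthalSpace) : Mat3 A := v.2.2.1

/-- The scalar component of highest degree. -/
def top (v : C.FreudenthalSpace) : ℂ := v.2.2.2

lemma low_herm (v : C.FreudenthalSpace) : C.IsHerm v.low := v.2.1.2
lemma high_herm (v : C.FreudenthalSpace) : C.IsHerm v.high := v.2.2.1.2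

/-- The vector with given components. -/
def mk (α : ℂ) (x y : Mat3 A) (β : ℂ) (hx : C.IsHerm x) (hy : C.IsHerm y) : C.FreudenthalSpace :=
  (α, ⟨x, hx⟩, ⟨y, hy⟩, β)

@[ext]
lemma ext {v w : C.FreudenthalSpace} (h1 : v.bot = w.bot) (h2 : v.low = w.low)
    (h3 : v.high = w.high) (h4 : v.top = w.top) : v = w :=
  Prod.ext h1 (Prod.ext (Subtype.ext h2) (Prod.ext (Subtype.ext h3) h4))

section
variable (v w : C.FreudenthalSpace) (k : ℂ)
@[simp] lemma bot_add : (v + w).bot = v.bot + w.bot := rfl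
@[simp] lemma low_add : (v + w).low = v.low + w.low := rfl
@[simp] lemma high_add : (v + w).high = v.high + w.high := rfl
@[simp] lemma top_add : (v + w).top = v.top + w.top := rfl
@[simp] lemma bot_sub : (v - w).bot = v.bot - w.bot := rfl
@[simp] lemma low_sub : (v - w).low = v.low - w.low := rfl
@[simp] lemma high_sub : (v - w).high = v.high - w.high := rfl
@[simp] lemma top_sub : (v - w).top = v.top - w.top := rfl
@[simp] lemma bot_smul : (k • v).bot = k * v.bot := rfl
@[simp] lemma low_smul : (k • v).low = k • v.low := rfl
@[simp] lemma high_smul : (k • v).high = k • v.high := rfl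
@[simp] lemma top_smul : (k • v).top = k * v.top := rfl
@[simp] lemma bot_zero : (0 : C.FreudenthalSpace).bot = 0 := rfl
@[simp] lemma top_zero : (0 : C.FreudenthalSpace).top = 0 := rfl
end

open conformal

variable {hC : C.IsComposition}

/-- The action of the conformal algebra: the upper left block preserves the degree, the upper right
block raises it, the lower left block lowers it. The double conjugate transpose is removed in
`high_lie`. -/
instance : Bracket (C.conformal hC) C.FreudenthalSpace where
  bracket X v := mk
    (-(C.tr (ul X) * v.bot) - C.tr (ll X * v.low))
    (ul X * v.low + v.low * C.adj (ul X) + C.sharp (ll X) v.high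
      - (C.tr (ul X) • v.low + v.bot • ur X))
    (C.tr (ul X) • v.high + C.sharp (ur X) v.low
      - (C.adj (ul X) * v.high + v.high * C.adj (C.adj (ul X)) + v.top • ll X))
    (C.tr (ul X) * v.top - C.tr (ur X * v.high))
    (IsComposition.isHerm_sub (C.isHerm_add (hC.isHerm_act _ v.low_herm)
        (hC.isHerm_sharp (ll_herm X) v.high_herm))
      (C.isHerm_add (C.isHerm_smul _ v.low_herm) (C.isHerm_smul _ (ur_herm X))))
    (IsComposition.isHerm_sub (C.isHerm_add (C.isHerm_smul _ v.high_herm)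
        (hC.isHerm_sharp (ur_herm X) v.low_herm))
      (C.isHerm_add (hC.isHerm_act _ v.high_herm) (C.isHerm_smul _ (ll_herm X))))

variable (X Y : C.conformal hC) (v w : C.FreudenthalSpace)

lemma bot_lie : (⁅X, v⁆ : C.FreudenthalSpace).bot =
    -(C.tr (ul X) * v.bot) - C.tr (ll X * v.low) := rfl

lemma low_lie : (⁅X, v⁆ : C.FreudenthalSpace).low =
    ul X * v.low + v.low * C.adj (ul X) + C.sharp (ll X) v.high
      - (C.tr (ul X) • v.low + v.bot • ur X) := rfl

lemma high_lie : (⁅X, v⁆ : C.FreudenthalSpace).high =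
    C.tr (ul X) • v.high + C.sharp (ur X) v.low
      - (C.adj (ul X) * v.high + v.high * ul X + v.top • ll X) := by
  nth_rw 3 [← hC.adj_adj (ul X)]
  rfl

lemma top_lie : (⁅X, v⁆ : C.FreudenthalSpace).top =
    C.tr (ul X) * v.top - C.tr (ur X * v.high) := rfl

lemma bot_lie_lie : (⁅X, ⁅Y, v⁆⁆ : C.FreudenthalSpace).bot =
    (⁅⁅X, Y⁆, v⁆ + ⁅Y, ⁅X, v⁆⁆ : C.FreudenthalSpace).bot := by
  have h1 := hC.tr_mul_sharp_left (ll X) (ll Y) v.high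
  have h2 := hC.tr_mul_comm (ur X) (ll Y)
  have h3 := hC.tr_mul_comm (ur Y) (ll X)
  have h4 := hC.tr_mul_comm (ul X) (ul Y)
  have h5 := hC.tr_mul_comm (C.adj (ul X)) (ll Y * v.low)
  have h6 := hC.tr_mul_comm (C.adj (ul Y)) (ll X * v.low)
  simp only [bot_add, bot_lie, low_lie, ul_lie, ll_lie, mul_add, mul_sub, add_mul, sub_mul, tr_add,
    tr_sub, tr_smul, mul_smul_comm, mul_assoc] at h1 h5 h6 ⊢
  linear_combination -h1 + v.bot * h2 - v.bot * h3 + v.bot * h4 - h5 + h6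

lemma top_lie_lie : (⁅X, ⁅Y, v⁆⁆ : C.FreudenthalSpace).top =
    (⁅⁅X, Y⁆, v⁆ + ⁅Y, ⁅X, v⁆⁆ : C.FreudenthalSpace).top := by
  have h1 := hC.tr_mul_sharp_left (ur X) (ur Y) v.low
  have h4 := hC.tr_mul_comm (ul X) (ul Y)
  have h5 := hC.tr_mul_comm (ul X) (ur Y * v.high)
  have h6 := hC.tr_mul_comm (ul Y) (ur X * v.high)
  simp only [top_add, top_lie, high_lie, ul_lie, ur_lie, mul_add, mul_sub, add_mul, sub_mul, tr_add,
    tr_sub, tr_smul, mul_smul_comm, mul_assoc] at h1 h5 h6 ⊢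
  linear_combination -h1 - v.top * h4 + h5 - h6

lemma low_lie_lie : (⁅X, ⁅Y, v⁆⁆ : C.FreudenthalSpace).low =
    (⁅⁅X, Y⁆, v⁆ + ⁅Y, ⁅X, v⁆⁆ : C.FreudenthalSpace).low := by
  have h1 := hC.sharp_sharp (ll_herm X) (ur_herm Y) v.low_herm
  have h2 := hC.sharp_sharp (ll_herm Y) (ur_herm X) v.low_herm
  have h3 := hC.sharp_act (C.adj (ul X)) (ll_herm Y) v.high_herm
  have h4 := hC.sharp_act (C.adj (ul Y)) (ll_herm X) v.high_herm
  have h5 := hC.tr_mul_comm (ul X) (ul Y)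
  have h6 := hC.tr_mul_comm (ur X) (ll Y)
  have h7 := hC.tr_mul_comm (ur Y) (ll X)
  have h8 := hC.sharp_comm (ll X) (ll Y)
  have e1 : C.adj (ur X) = ur X := ur_herm X
  have e2 : C.adj (ur Y) = ur Y := ur_herm Y
  have e3 : C.adj (ll X) = ll X := ll_herm X
  have e4 : C.adj (ll Y) = ll Y := ll_herm Y
  simp only [low_add, low_lie, bot_lie, high_lie, ul_lie, ur_lie, ll_lie, mul_add, mul_sub, add_mul,
    sub_mul, tr_add, tr_sub, mul_smul_comm, smul_mul_assoc, mul_assoc, adj_add, adj_sub,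
    hC.adj_mul, hC.adj_adj, e1, e2, e3, e4, hC.sharp_add_right, hC.sharp_add_left,
    hC.sharp_sub_left, hC.sharp_sub_right, hC.sharp_smul_right, hC.tr_adj, h5, h6, h7]
    at h1 h2 h3 h4 ⊢
  linear_combination (norm := module) h1 - h2 + h3 - h4 - v.top • h8

lemma high_lie_lie : (⁅X, ⁅Y, v⁆⁆ : C.FreudenthalSpace).high =
    (⁅⁅X, Y⁆, v⁆ + ⁅Y, ⁅X, v⁆⁆ : C.FreudenthalSpace).high := by
  have h1 := hC.sharp_sharp (ur_herm X) (ll_herm Y) v.high_herm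
  have h2 := hC.sharp_sharp (ur_herm Y) (ll_herm X) v.high_herm
  have h3 := hC.sharp_act (ul X) (ur_herm Y) v.low_herm
  have h4 := hC.sharp_act (ul Y) (ur_herm X) v.low_herm
  have h5 := hC.tr_mul_comm (ul X) (ul Y)
  have h6 := hC.tr_mul_comm (ur X) (ll Y)
  have h7 := hC.tr_mul_comm (ur Y) (ll X)
  have h8 := hC.sharp_comm (ur X) (ur Y)
  have e1 : C.adj (ur X) = ur X := ur_herm X
  have e2 : C.adj (ur Y) = ur Y := ur_herm Y
  have e3 : C.adj (ll X) = ll X := ll_herm X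
  have e4 : C.adj (ll Y) = ll Y := ll_herm Y
  simp only [high_add, low_lie, top_lie, high_lie, ul_lie, ur_lie, ll_lie, mul_add, mul_sub,
    add_mul, sub_mul, tr_add, tr_sub, mul_smul_comm, smul_mul_assoc, mul_assoc, adj_add, adj_sub,
    hC.adj_mul, e1, e2, e3, e4, hC.sharp_add_right, hC.sharp_add_left,
    hC.sharp_sub_left, hC.sharp_sub_right, hC.sharp_smul_right, h5, h6, h7]
    at h1 h2 h3 h4 ⊢
  linear_combination (norm := module) h1 - h2 - h3 + h4 - v.bot • h8

instance : LieRingModule (C.conformal hC) C.FreudenthalSpace where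
  add_lie X Y v := by
    ext1 <;> simp only [bot_lie, low_lie, high_lie, top_lie, bot_add, low_add, high_add, top_add,
      ul_add, ur_add, ll_add, tr_add, add_mul, mul_add, adj_add, hC.sharp_add_left]
    · ring
    · module
    · module
    · ring
  lie_add X v w := by
    ext1 <;> simp only [bot_lie, low_lie, high_lie, top_lie, bot_add, low_add, high_add, top_add,
      tr_add, add_mul, mul_add, hC.sharp_add_right]
    · ring
    · module
    · module
    · ring
  leibniz_lie X Y v := ext (bot_lie_lie X Y v) (low_lie_lie X Y v) (high_lie_lie X Y v)
    (top_lie_lie X Y v)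

instance : LieModule ℂ (C.conformal hC) C.FreudenthalSpace where
  smul_lie k X v := by
    ext1 <;> simp only [bot_lie, low_lie, high_lie, top_lie, bot_smul, low_smul, high_smul,
      top_smul, ul_smul, ur_smul, ll_smul, tr_smul, smul_mul_assoc, mul_smul_comm, adj_smul,
      hC.sharp_smul_left]
    · ring
    · module
    · module
    · ring
  lie_smul k X v := by
    ext1 <;> simp only [bot_lie, low_lie, high_lie, top_lie, bot_smul, low_smul, high_smul,
      top_smul, tr_smul, smul_mul_assoc, mul_smul_comm, hC.sharp_smul_right]
    · ring
    · module
    · module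
    · ring

/-! ### Irreducibility and the symplectic form -/

variable (hC) in
/-- A nonzero subspace that is stable under the conformal algebra is the whole space. The identity
matrix suffices for all but one of the raisings, since `1 # x` determines `x`. -/
lemma eq_top_of_stable {N : Submodule ℂ C.FreudenthalSpace} (hN : N ≠ ⊥)
    (h : ∀ (X : C.conformal hC), ∀ v ∈ N, (⁅X, v⁆ : C.FreudenthalSpace) ∈ N) : N = ⊤ := by
  -- the raising and the lowering operators
  have up : ∀ s, C.IsHerm s → ∀ v ∈ N, ∃ w ∈ N, w.bot = 0 ∧ w.low = -(v.bot • s) ∧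
      w.high = C.sharp s v.low ∧ w.top = -C.tr (s * v.high) := by
    intro s hs v hv
    refine ⟨_, h (conformal.mk hC 0 s 0 (zero_mem _) hs C.adj_zero) v hv, ?_, ?_, ?_, ?_⟩
    · simp [bot_lie, conformal.mk, ul, ll, tr_zero]
    · simp [low_lie, conformal.mk, ul, ll, ur, tr_zero, hC.zero_sharp, adj_zero]
    · simp [high_lie, conformal.mk, ul, ll, ur, tr_zero, adj_zero]
    · simp [top_lie, conformal.mk, ul, ur, tr_zero]
  have down : ∀ s, C.IsHerm s → ∀ v ∈ N, ∃ w ∈ N, w.bot = -C.tr (s * v.low) ∧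
      w.low = C.sharp s v.high ∧ w.high = -(v.top • s) ∧ w.top = 0 := by
    intro s hs v hv
    refine ⟨_, h (conformal.mk hC 0 0 s (zero_mem _) C.adj_zero hs) v hv, ?_, ?_, ?_, ?_⟩
    · simp [bot_lie, conformal.mk, ul, ll, tr_zero]
    · simp [low_lie, conformal.mk, ul, ll, ur, tr_zero, adj_zero]
    · simp [high_lie, conformal.mk, ul, ll, ur, tr_zero, hC.zero_sharp, adj_zero]
    · simp [top_lie, conformal.mk, ul, ur, tr_zero]
  -- raising a nonzero vector often enough produces a vector of highest degree
  have step3 : ∀ v ∈ N, v.bot = 0 → v.low = 0 → v.high ≠ 0 →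
      ∃ w ∈ N, w.bot = 0 ∧ w.low = 0 ∧ w.high = 0 ∧ w.top ≠ 0 := by
    intro v hv hb hl hh
    obtain ⟨s, hs, hsv⟩ : ∃ s, C.IsHerm s ∧ C.tr (s * v.high) ≠ 0 := by
      by_contra! hcon
      exact hh (hC.eq_zero_of_tr_mul v.high_herm hcon)
    obtain ⟨w, hw, h1, h2, h3, h4⟩ := up s hs v hv
    refine ⟨w, hw, h1, by rw [h2, hb, zero_smul, neg_zero], by rw [h3, hl, hC.sharp_zero], ?_⟩
    rw [h4]
    exact neg_ne_zero.mpr hsv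
  have step2 : ∀ v ∈ N, v.bot = 0 → v.low ≠ 0 →
      ∃ w ∈ N, w.bot = 0 ∧ w.low = 0 ∧ w.high = 0 ∧ w.top ≠ 0 := by
    intro v hv hb hl
    obtain ⟨w, hw, h1, h2, h3, h4⟩ := up 1 hC.isHerm_one v hv
    refine step3 w hw h1 (by rw [h2, hb, zero_smul, neg_zero]) ?_
    rw [h3]
    intro h0
    apply hl
    have ht := congrArg C.tr h0
    rw [hC.sharp_one, tr_sub, tr_smul, hC.tr_one, tr_zero] at ht
    have ht' : C.tr v.low = 0 := by linear_combination ht / 2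
    rw [hC.sharp_one, ht', zero_smul, zero_sub, neg_eq_zero] at h0
    exact h0
  obtain ⟨v, hv, hv0⟩ := N.exists_mem_ne_zero_of_ne_bot hN
  obtain ⟨u, hu, u1, u2, u3, u4⟩ : ∃ w ∈ N, w.bot = 0 ∧ w.low = 0 ∧ w.high = 0 ∧ w.top ≠ 0 := by
    by_cases hb : v.bot = 0
    · by_cases hl : v.low = 0
      · by_cases hh : v.high = 0
        · exact ⟨v, hv, hb, hl, hh, fun ht => hv0 (ext hb hl hh ht)⟩
        · exact step3 v hv hb hl hh
      · exact step2 v hv hb hl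
    · obtain ⟨w, hw, h1, h2, h3, h4⟩ := up 1 hC.isHerm_one v hv
      refine step2 w hw h1 ?_
      rw [h2]
      intro h0
      have ht := congrArg C.tr h0
      rw [tr_neg, tr_smul, hC.tr_one, tr_zero] at ht
      exact hb (by linear_combination -ht / 3)
  -- lowering that vector produces everything
  have m4 : ∀ β : ℂ, mk 0 0 0 β C.adj_zero C.adj_zero ∈ N := by
    intro β
    have e : mk 0 0 0 β C.adj_zero C.adj_zero = (β * u.top⁻¹) • u := by
      ext1
      · rw [bot_smul, u1, mul_zero]; rfl
      · rw [low_smul, u2, smul_zero]; rfl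
      · rw [high_smul, u3, smul_zero]; rfl
      · rw [top_smul, mul_assoc, inv_mul_cancel₀ u4, mul_one]; rfl
    rw [e]
    exact N.smul_mem _ hu
  have m3 : ∀ y (hy : C.IsHerm y), mk 0 0 y 0 C.adj_zero hy ∈ N := by
    intro y hy
    obtain ⟨w, hw, h1, h2, h3, h4⟩ := down y hy _ (m4 (-1))
    have e : mk 0 0 y 0 C.adj_zero hy = w := by
      ext1
      · rw [h1, show low (mk 0 0 0 (-1) C.adj_zero C.adj_zero) = (0 : Mat3 A) from rfl, mul_zero,
          tr_zero, neg_zero]; rfl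
      · rw [h2, show high (mk 0 0 0 (-1) C.adj_zero C.adj_zero) = (0 : Mat3 A) from rfl,
          hC.sharp_zero]; rfl
      · rw [h3, show top (mk 0 0 0 (-1) C.adj_zero C.adj_zero) = (-1 : ℂ) from rfl, neg_one_smul,
          neg_neg]; rfl
      · rw [h4]; rfl
    rw [e]
    exact hw
  have m2 : ∀ x (hx : C.IsHerm x), mk 0 x 0 0 hx C.adj_zero ∈ N := by
    intro x hx
    obtain ⟨y, hy, rfl⟩ := hC.exists_sharp_one hx
    obtain ⟨w, hw, h1, h2, h3, h4⟩ := down 1 hC.isHerm_one _ (m3 y hy)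
    have e : mk 0 (C.sharp 1 y) 0 0 hx C.adj_zero = w := by
      ext1
      · rw [h1, show low (mk 0 0 y 0 C.adj_zero hy) = (0 : Mat3 A) from rfl, mul_zero,
          tr_zero, neg_zero]; rfl
      · rw [h2]; rfl
      · rw [h3, show top (mk 0 0 y 0 C.adj_zero hy) = (0 : ℂ) from rfl, zero_smul,
          neg_zero]; rfl
      · rw [h4]; rfl
    rw [e]
    exact hw
  have m1 : ∀ α : ℂ, mk α 0 0 0 C.adj_zero C.adj_zero ∈ N := by
    intro α
    obtain ⟨w, hw, h1, h2, h3, h4⟩ := down _ hC.isHerm_one _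
      (m2 _ (C.isHerm_smul (-α / 3) hC.isHerm_one))
    have e : mk α 0 0 0 C.adj_zero C.adj_zero = w := by
      ext1
      · rw [h1]
        change α = -C.tr (1 * ((-α / 3) • (1 : Mat3 A)))
        rw [one_mul, tr_smul, hC.tr_one]
        ring
      · rw [h2]
        exact (hC.sharp_zero 1).symm
      · rw [h3]
        change (0 : Mat3 A) = -((0 : ℂ) • 1)
        rw [zero_smul, neg_zero]
      · rw [h4]; rfl
    rw [e]
    exact hw
  refine eq_top_iff.mpr fun v _ => ?_
  have e : v = mk v.bot 0 0 0 C.adj_zero C.adj_zero + mk 0 v.low 0 0 v.low_herm C.adj_zero +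
      mk 0 0 v.high 0 C.adj_zero v.high_herm + mk 0 0 0 v.top C.adj_zero C.adj_zero := by
    ext1
    · change v.bot = v.bot + 0 + 0 + 0
      ring
    · change v.low = 0 + v.low + 0 + 0
      module
    · change v.high = 0 + 0 + v.high + 0
      module
    · change v.top = 0 + 0 + 0 + v.top
      ring
  rw [e]
  exact N.add_mem (N.add_mem (N.add_mem (m1 _) (m2 _ v.low_herm)) (m3 _ v.high_herm)) (m4 _)

variable (C) in
/-- The symplectic form of the Freudenthal triple system. -/
def symplecticForm : LinearMap.BilinForm ℂ C.FreudenthalSpace :=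
  LinearMap.mk₂ ℂ
    (fun v w => v.bot * w.top - v.top * w.bot + (C.tr (w.low * v.high) - C.tr (v.low * w.high)))
    (fun u v w => by
      simp only [bot_add, low_add, high_add, top_add, add_mul, mul_add, tr_add]
      ring)
    (fun k v w => by
      simp only [bot_smul, low_smul, high_smul, top_smul, smul_mul_assoc, mul_smul_comm, tr_smul,
        smul_eq_mul]
      ring)
    (fun u v w => by
      simp only [bot_add, low_add, high_add, top_add, add_mul, mul_add, tr_add]
      ring)
    (fun k v w => by
      simp only [bot_smul, low_smul, high_smul, top_smul, smul_mul_assoc, mul_smul_comm, tr_smul,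
        smul_eq_mul]
      ring)

lemma symplecticForm_apply : symplecticForm C v w =
    v.bot * w.top - v.top * w.bot + (C.tr (w.low * v.high) - C.tr (v.low * w.high)) := rfl

lemma symplecticForm_isAlt : (symplecticForm C).IsAlt := fun v => by
  rw [symplecticForm_apply]; ring

lemma symplecticForm_invariant :
    symplecticForm C ⁅X, v⁆ w + symplecticForm C v ⁅X, w⁆ = 0 := by
  have h1 := hC.tr_mul_comm (C.sharp (ll X) v.high) w.high
  have h2 := hC.tr_mul_comm (C.sharp (ll X) w.high) v.high
  have h3 := hC.tr_mul_sharp_left w.high (ll X) v.high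
  have h3' := hC.tr_mul_sharp_left v.high (ll X) w.high
  have h4 := hC.tr_mul_sharp_left v.low (ur X) w.low
  have h5 := hC.tr_mul_sharp_left w.low (ur X) v.low
  have h6 := hC.sharp_comm v.low w.low
  have h7 := hC.sharp_comm v.high w.high
  have h8 := hC.tr_mul_comm (ul X) (v.low * w.high)
  have h9 := hC.tr_mul_comm (ul X) (w.low * v.high)
  have h10 := hC.tr_mul_comm (ll X) v.low
  have h11 := hC.tr_mul_comm (ll X) w.low
  simp only [symplecticForm_apply, bot_lie, low_lie, high_lie, top_lie, add_mul, mul_add, sub_mul,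
    mul_sub, tr_add, tr_sub, tr_smul, smul_mul_assoc, mul_smul_comm, mul_assoc, h1, h2, h3, h3',
    h4, h5, h6, h7, h10, h11] at h8 h9 ⊢
  linear_combination h9 - h8

lemma symplecticForm_nondegenerate (hC : C.IsComposition) : (symplecticForm C).Nondegenerate := by
  refine (LinearMap.IsAlt.isRefl symplecticForm_isAlt).nondegenerate_iff_separatingLeft.mpr
    fun v hv => ?_
  have hz := C.adj_zero
  ext1
  · have h := hv (mk 0 0 0 1 hz hz)
    rw [symplecticForm_apply] at h
    rw [bot_zero]
    simpa [symplecticForm_apply, mk, bot, low, high, top, tr_zero] using h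
  · refine hC.eq_zero_of_tr_mul v.low_herm fun x hx => ?_
    have h := hv (mk 0 0 x 0 hz hx)
    rw [symplecticForm_apply] at h
    rw [hC.tr_mul_comm]
    simpa [symplecticForm_apply, mk, bot, low, high, top, tr_zero] using h
  · refine hC.eq_zero_of_tr_mul v.high_herm fun x hx => ?_
    have h := hv (mk 0 x 0 0 hx hz)
    rw [symplecticForm_apply] at h
    simpa [symplecticForm_apply, mk, bot, low, high, top, tr_zero] using h
  · have h := hv (mk 1 0 0 0 hz hz)
    rw [symplecticForm_apply] at h
    rw [top_zero]
    simpa [symplecticForm_apply, mk, bot, low, high, top, tr_zero] using h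

end FreudenthalSpace

end Coordinates

/-! ### The block matrices represent the intermediate algebra -/

section tens

variable {A : Type} [Ring A] [Algebra ℂ A]

lemma tens_add_left (a b : Mat3 ℂ) (x : Mat3 A) : tens (a + b) x = tens a x + tens b x := by
  ext; simp [tens, add_smul]

lemma tens_sub_left (a b : Mat3 ℂ) (x : Mat3 A) : tens (a - b) x = tens a x - tens b x := by
  ext; simp [tens, sub_smul]

lemma tens_add_right (a : Mat3 ℂ) (x y : Mat3 A) : tens a (x + y) = tens a x + tens a y := by
  ext; simp [tens]

lemma tens_sub_right (a : Mat3 ℂ) (x y : Mat3 A) : tens a (x - y) = tens a x - tens a y := by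
  ext; simp [tens, smul_sub]

lemma tens_neg_right (a : Mat3 ℂ) (x : Mat3 A) : tens a (-x) = -tens a x := by
  ext; simp [tens]

lemma tens_smul_left (c : ℂ) (a : Mat3 ℂ) (x : Mat3 A) : tens (c • a) x = c • tens a x := by
  ext; simp [tens, mul_smul]

lemma tens_smul_right (c : ℂ) (a : Mat3 ℂ) (x : Mat3 A) : tens a (c • x) = c • tens a x := by
  ext; simp [tens, smul_comm c]

lemma tens_one_left_injective : Function.Injective (tens (A := A) 1) := by
  intro x y h
  ext i j
  simpa [tens] using congrFun (congrFun h (0, i)) (0, j)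

end tens

namespace Coordinates

variable {A : Type} [Ring A] [Algebra ℂ A] {C : Coordinates A}

lemma IsComposition.block_injective (hC : C.IsComposition) : Function.Injective C.block := by
  rintro ⟨a, a₁, s, r⟩ ⟨b, b₁, s', r'⟩ h
  obtain ⟨h1, h2, h3, h4⟩ : tens a 1 + tens 1 a₁ = tens b 1 + tens 1 b₁ ∧ s = s' ∧ r = r' ∧
      -tens 1 (C.adj a₁) = -tens 1 (C.adj b₁) := by
    simpa only [block, Prod.mk.injEq] using h
  have h5 : a₁ = b₁ := by
    rw [← hC.adj_adj a₁, tens_one_left_injective (neg_injective h4), hC.adj_adj]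
  rw [h5, add_left_inj] at h1
  have h6 : a = b := by
    ext i j
    simpa [tens, hC.re_one] using congrArg C.re (congrFun (congrFun h1 (i, 0)) (j, 0))
  rw [h2, h3, h5, h6]

open conformal FreudenthalSpace

variable {hC : C.IsComposition}

/-- The data of the block matrix that represents an element of the intermediate algebra. The
identity matrix in the upper left block goes to `diag(2, -1, -1)` and the singlet to
`diag(0, 1, -1)` in `M₃(ℂ)`. -/
def blockData (p : Intermediate (C.conformal hC) C.FreudenthalSpace) : BlockData A where
  a := !![2 / 3 * C.tr (ul p.1), 0, p.2.2.top;
    p.2.2.bot, p.2.1 - 1 / 3 * C.tr (ul p.1), 0;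
    0, 0, -p.2.1 - 1 / 3 * C.tr (ul p.1)]
  a₁ := ul p.1 - (1 / 3 * C.tr (ul p.1)) • 1
  sPlus := ![ur p.1, p.2.2.low, 0]
  sMinus := ![-ll p.1, 0, p.2.2.high]

lemma blockData_admissible (p : Intermediate (C.conformal hC) C.FreudenthalSpace) :
    C.Admissible (blockData p) where
  trace_a := by
    simp [blockData, Matrix.trace, Fin.sum_univ_three]
    ring
  a_12 := rfl
  a_23 := rfl
  a_31 := rfl
  a_32 := rfl
  a₁_mem := ul_mem p.1
  sPlus_herm i := by
    fin_cases i
    exacts [ur_herm p.1, p.2.2.low_herm, C.adj_zero]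
  sMinus_herm i := by
    fin_cases i
    exacts [C.hermitian.neg_mem (ll_herm p.1), C.adj_zero, p.2.2.high_herm]
  sPlus_3 := rfl
  sMinus_2 := rfl

lemma exists_blockData (hC : C.IsComposition) {D : BlockData A} (hD : C.Admissible D) :
    ∃ p : Intermediate (C.conformal hC) C.FreudenthalSpace, blockData p = D := by
  -- half of the first diagonal entry of `a` is the scalar part of the upper left block
  have ht : C.tr (D.a₁ + (D.a 0 0 / 2) • 1) = 3 / 2 * D.a 0 0 := by
    rw [tr_add, tr_smul, hC.tr_one, hC.tr_eq_zero hD.a₁_mem]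
    ring
  have e : D.a₁ + (D.a 0 0 / 2) • 1 - (1 / 3 * C.tr (D.a₁ + (D.a 0 0 / 2) • 1)) • 1 = D.a₁ := by
    rw [ht]; module
  have h3 : D.a 0 0 + D.a 1 1 + D.a 2 2 = 0 := by
    have h := hD.trace_a
    rwa [Matrix.trace, Fin.sum_univ_three] at h
  have hn : C.IsHerm (-D.sMinus 0) := C.hermitian.neg_mem (hD.sMinus_herm 0)
  refine ⟨(conformal.mk hC (D.a₁ + (D.a 0 0 / 2) • 1) (D.sPlus 0) (-D.sMinus 0) ?_
      (hD.sPlus_herm 0) hn, (D.a 1 1 - D.a 2 2) / 2, FreudenthalSpace.mk (D.a 1 0) (D.sPlus 1)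
      (D.sMinus 2) (D.a 0 2) (hD.sPlus_herm 1) (hD.sMinus_herm 2)), ?_⟩
  · rw [mem_structureAlgebra, e]
    exact hD.a₁_mem
  · obtain ⟨a, a₁, s, r⟩ := D
    have g1 := hD.a_12
    have g2 := hD.a_23
    have g3 := hD.a_31
    have g4 := hD.a_32
    have g5 := hD.sPlus_3
    have g6 := hD.sMinus_2
    dsimp only at *
    simp only [blockData, BlockData.mk.injEq]
    refine ⟨?_, e, ?_, ?_⟩
    · ext i j
      fin_cases i <;> fin_cases j <;>
        simp [conformal.mk, FreudenthalSpace.mk, ul, bot, top, g1, g2, g3, g4, ht]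
      · ring
      · linear_combination -h3 / 2
      · linear_combination -h3 / 2
    · ext1 i
      fin_cases i
      exacts [rfl, rfl, g5.symm]
    · ext1 i
      fin_cases i
      exacts [neg_neg _, g6.symm, rfl]

/-- Both diagonal blocks of the bracket, with the contributions to `M₃(ℂ)` and `M₃(A)`
collected. -/
lemma blockBracket_eq (X Y : BlockData A) : C.blockBracket X Y =
    (tens (dotMul X.a Y.a - dotMul Y.a X.a
        + ((1 / 3 * C.trForm (X.sPlus 0) (Y.sMinus 0)) • (1 : Mat3 ℂ)
          - Matrix.of fun i j => (1 - Matrix.single (1 : Fin 3) (2 : Fin 3) (1 : ℂ) i j)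
            * C.trForm (X.sPlus i) (Y.sMinus j))
        - ((1 / 3 * C.trForm (Y.sPlus 0) (X.sMinus 0)) • (1 : Mat3 ℂ)
          - Matrix.of fun i j => (1 - Matrix.single (1 : Fin 3) (2 : Fin 3) (1 : ℂ) i j)
            * C.trForm (Y.sPlus i) (X.sMinus j))) 1
      + tens 1 (X.a₁ * Y.a₁ - Y.a₁ * X.a₁
        + ((1 / 3 * C.trForm (X.sPlus 0) (Y.sMinus 0)) • (1 : Mat3 A) - X.sPlus 0 * Y.sMinus 0)
        - ((1 / 3 * C.trForm (Y.sPlus 0) (X.sMinus 0)) • (1 : Mat3 A) - Y.sPlus 0 * X.sMinus 0)),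
      (C.blockBracket X Y).2.1, (C.blockBracket X Y).2.2.1,
      tens 1 (C.adj X.a₁ * C.adj Y.a₁ - C.adj Y.a₁ * C.adj X.a₁
        + ((1 / 3 * C.trForm (X.sMinus 0) (Y.sPlus 0)) • (1 : Mat3 A) - X.sMinus 0 * Y.sPlus 0)
        - ((1 / 3 * C.trForm (Y.sMinus 0) (X.sPlus 0)) • (1 : Mat3 A)
          - Y.sMinus 0 * X.sPlus 0))) := by
  refine Prod.ext ?_ (Prod.ext rfl (Prod.ext rfl ?_))
  · simp only [blockBracket, diamond, tens_add_left, tens_sub_left _ _ (1 : Mat3 A),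
      tens_add_right, tens_sub_right 1]
    abel
  · simp only [blockBracket, bullet, tens_add_right, tens_sub_right 1]

/-- The bracket of block matrices is the bracket of the intermediate algebra. At the position `E₂₃`
both sides vanish, because of the corrections in `dotMul` and `diamond`. -/
lemma blockBracket_blockData (p q : Intermediate (C.conformal hC) C.FreudenthalSpace) :
    C.blockBracket (blockData p) (blockData q) = C.block (blockData ⁅p, q⁆) := by
  have l1 : (⁅p, q⁆ : Intermediate (C.conformal hC) C.FreudenthalSpace).1 = ⁅p.1, q.1⁆ := rfl
  have l2 : (⁅p, q⁆ : Intermediate (C.conformal hC) C.FreudenthalSpace).2.1 = 0 := rfl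
  have l3 : (⁅p, q⁆ : Intermediate (C.conformal hC) C.FreudenthalSpace).2.2 =
    (⁅p.1, q.2.2⁆ + p.2.1 • q.2.2) - (⁅q.1, p.2.2⁆ + q.2.1 • p.2.2) := rfl
  generalize (⁅p, q⁆ : Intermediate (C.conformal hC) C.FreudenthalSpace) = u at *
  obtain ⟨X, c, v⟩ := p
  obtain ⟨Y, d, w⟩ := q
  obtain ⟨Z, k, z⟩ := u
  dsimp only at l1 l2 l3
  subst l1 l2 l3
  have hz : C.adj 0 = 0 := C.adj_zero
  have t1 := hC.tr_mul_comm (ul X) (ul Y)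
  have t2 := hC.tr_mul_comm (ur X) (ll Y)
  have t3 := hC.tr_mul_comm (ur Y) (ll X)
  have e1 : C.adj (ur X) = ur X := ur_herm X
  have e2 : C.adj (ur Y) = ur Y := ur_herm Y
  have e3 : C.adj (ll X) = ll X := ll_herm X
  have e4 : C.adj (ll Y) = ll Y := ll_herm Y
  rw [blockBracket_eq, block]
  refine Prod.ext ?_ (Prod.ext ?_ (Prod.ext ?_ ?_))
  · dsimp only
    congr 2
    · ext i j
      fin_cases i <;> fin_cases j <;>
      simp [blockData, dotMul, hC.trForm_eq, Matrix.mul_apply, Matrix.single,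
        bot_lie, top_lie, ul_lie, tr_zero, tr_add, tr_sub, tr_neg]
      · linear_combination -2 / 3 * t1
      · ring
      · linear_combination -hC.tr_mul_comm (ll Y) v.low + hC.tr_mul_comm (ll X) w.low
      · linear_combination 1 / 3 * t1
      · linear_combination 1 / 3 * t1
    · simp only [blockData, hC.trForm_eq, ul_lie, tr_add, tr_sub]
      simp only [Matrix.cons_val_zero, mul_neg, tr_neg, t1, mul_sub, sub_mul, mul_smul_comm,
        smul_mul_assoc, mul_one, one_mul]
      module
  · dsimp only
    ext1 i
    fin_cases i <;> simp [blockBracket, blockData, Fin.sum_univ_three, cross, ur_lie, low_lie] <;>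
    simp only [hC.zero_sharp, hC.sharp_zero, sub_self, hC.sharp_neg_left, hC.sharp_neg_right,
      adj_sub, adj_smul, hC.adj_one, mul_sub, sub_mul, mul_smul_comm, smul_mul_assoc, mul_one,
      one_mul, hC.sharp_comm v.high]
    · module
    · module
  · dsimp only
    ext1 i
    fin_cases i <;> simp [blockBracket, blockData, Fin.sum_univ_three, cross, ll_lie, high_lie] <;>
    simp only [hC.zero_sharp, hC.sharp_zero, sub_self, adj_sub, adj_smul, hC.adj_one, mul_sub,
      sub_mul, mul_smul_comm, smul_mul_assoc, mul_one, one_mul, hC.sharp_comm v.low]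
    · module
    · module
  · dsimp only
    rw [← tens_neg_right]
    congr 1
    simp only [blockData, hC.trForm_eq, ul_lie, tr_add, tr_sub, adj_sub, adj_add, adj_smul,
      hC.adj_mul, hC.adj_one, e1, e2, e3, e4, t1]
    simp only [Matrix.cons_val_zero, neg_mul, tr_neg, t2, t3, mul_sub, sub_mul, mul_smul_comm,
      smul_mul_assoc, mul_one, one_mul]
    module

lemma block_blockData_add (p q : Intermediate (C.conformal hC) C.FreudenthalSpace) :
    C.block (blockData (p + q)) = C.block (blockData p) + C.block (blockData q) := by
  have h1 : (blockData (p + q)).a = (blockData p).a + (blockData q).a := by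
    ext i j
    have e : C.tr (ul (p + q).1) = C.tr (ul p.1) + C.tr (ul q.1) := tr_add _ _
    have e' : (p + q).2.1 = p.2.1 + q.2.1 := rfl
    fin_cases i <;> fin_cases j <;> simp [blockData, e, e']
    · ring
    · rfl
    · rfl
    · ring
    · ring
  have h2 : (blockData (p + q)).a₁ = (blockData p).a₁ + (blockData q).a₁ := by
    have e : ul (p + q).1 = ul p.1 + ul q.1 := rfl
    simp only [blockData, e, tr_add]
    module
  refine Prod.ext ?_ (Prod.ext ?_ (Prod.ext ?_ ?_))
  · simp only [block, Prod.fst_add, h1, h2, tens_add_left, tens_add_right]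
    abel
  · ext1 i
    fin_cases i
    exacts [rfl, rfl, (add_zero 0).symm]
  · ext1 i
    fin_cases i
    exacts [neg_add _ _, (add_zero 0).symm, rfl]
  · simp only [block, Prod.snd_add, h2, adj_add, tens_add_right]
    abel

lemma block_blockData_smul (k : ℂ) (p : Intermediate (C.conformal hC) C.FreudenthalSpace) :
    C.block (blockData (k • p)) = k • C.block (blockData p) := by
  have h1 : (blockData (k • p)).a = k • (blockData p).a := by
    ext i j
    have e : C.tr (ul (k • p).1) = k * C.tr (ul p.1) := tr_smul _ _
    have e' : (k • p).2.1 = k * p.2.1 := rfl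
    fin_cases i <;> fin_cases j <;> simp [blockData, e, e']
    · ring
    · rfl
    · rfl
    · ring
    · ring
  have h2 : (blockData (k • p)).a₁ = k • (blockData p).a₁ := by
    have e : ul (k • p).1 = k • ul p.1 := rfl
    simp only [blockData, e, tr_smul]
    module
  refine Prod.ext ?_ (Prod.ext ?_ (Prod.ext ?_ ?_))
  · simp only [block, Prod.smul_fst, h1, h2, tens_smul_left, tens_smul_right, smul_add]
  · ext1 i
    fin_cases i
    exacts [rfl, rfl, (smul_zero k).symm]
  · ext1 i
    fin_cases i
    exacts [(smul_neg k _).symm, (smul_zero k).symm, rfl]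
  · simp only [block, Prod.smul_snd, h2, adj_smul, tens_smul_right, smul_neg]

lemma blockData_injective :
    Function.Injective (blockData : Intermediate (C.conformal hC) C.FreudenthalSpace → _) := by
  intro p q h
  have ha := congrArg BlockData.a h
  have ha₁ := congrArg BlockData.a₁ h
  have hs := congrArg BlockData.sPlus h
  have hr := congrArg BlockData.sMinus h
  have h00 : 2 / 3 * C.tr (ul p.1) = 2 / 3 * C.tr (ul q.1) := congrFun (congrFun ha 0) 0
  have h11 : p.2.1 - 1 / 3 * C.tr (ul p.1) = q.2.1 - 1 / 3 * C.tr (ul q.1) :=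
    congrFun (congrFun ha 1) 1
  have ht : C.tr (ul p.1) = C.tr (ul q.1) := by linear_combination 3 / 2 * h00
  have hu : ul p.1 - (1 / 3 * C.tr (ul p.1)) • 1 = ul q.1 - (1 / 3 * C.tr (ul q.1)) • 1 := ha₁
  rw [ht, sub_left_inj] at hu
  rw [ht, sub_left_inj] at h11
  exact Prod.ext (conformal.ext hu (congrFun hs 0) (neg_injective (congrFun hr 0)))
    (Prod.ext h11 (FreudenthalSpace.ext (congrFun (congrFun ha 1) 0) (congrFun hs 1)
      (congrFun hr 2) (congrFun (congrFun ha 0) 2)))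

variable (hC) in
/-- The representation of the intermediate algebra by block matrices. -/
def representation : Intermediate (C.conformal hC) C.FreudenthalSpace ≃ₗ[ℂ] C.blockMatrices :=
  LinearEquiv.ofBijective
    { toFun := fun p => C.toBlock (blockData p) (blockData_admissible p)
      map_add' := fun p q => Subtype.ext (block_blockData_add p q)
      map_smul' := fun k p => Subtype.ext (by exact block_blockData_smul k p) }
    ⟨fun _ _ h => blockData_injective (hC.block_injective (congrArg Subtype.val h)), by
      rintro ⟨_, D, hD, rfl⟩
      obtain ⟨p, rfl⟩ := exists_blockData hC hD
      exact ⟨p, rfl⟩⟩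

lemma coe_representation (p : Intermediate (C.conformal hC) C.FreudenthalSpace) :
    (representation hC p : BlockMatrix A) = C.block (blockData p) := rfl

end Coordinates

namespace Coordinates

variable {A : Type} [Ring A] [Algebra ℂ A] {C : Coordinates A}

/-! ### Dimensions -/

/-- A Hermitian matrix is given by its diagonal, consisting of scalars, and its upper triangle. -/
def hermitianEquiv (hC : C.IsComposition) : C.hermitian ≃ₗ[ℂ] (Fin 3 → ℂ) × (Fin 3 → A) where
  toFun x := (fun i => C.re (x.1 i i), ![x.1 1 2, x.1 2 0, x.1 0 1])
  map_add' x y := by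
    refine Prod.ext (funext fun i => map_add _ _ _) (funext fun i => ?_)
    fin_cases i <;> rfl
  map_smul' k x := by
    refine Prod.ext (funext fun i => map_smul _ _ _) (funext fun i => ?_)
    fin_cases i <;> rfl
  invFun p := ⟨!![p.1 0 • 1, p.2 2, C.conj (p.2 1); C.conj (p.2 2), p.1 1 • 1, p.2 0;
      p.2 1, C.conj (p.2 0), p.1 2 • 1], by
    ext i j
    fin_cases i <;> fin_cases j <;> simp [adj, hC.conj_conj, hC.conj_one]⟩
  left_inv x := by
    have h : ∀ i j, C.conj (x.1 i j) = x.1 j i := fun i j => congrFun (congrFun x.2 j) i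
    ext i j
    fin_cases i <;> fin_cases j <;> simp [h]
    all_goals exact (hC.eq_smul_one_of_conj (h _ _)).symm
  right_inv p := by
    refine Prod.ext (funext fun i => ?_) (funext fun i => ?_) <;>
    fin_cases i <;> simp [hC.re_one]

/-- The components of the conformal algebra. -/
def conformalEquiv (hC : C.IsComposition) :
    C.conformal hC ≃ₗ[ℂ] C.structureAlgebra × C.hermitian × C.hermitian where
  toFun X := (⟨conformal.ul X, conformal.ul_mem X⟩, ⟨conformal.ur X, conformal.ur_herm X⟩,
    ⟨conformal.ll X, conformal.ll_herm X⟩)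
  map_add' _ _ := rfl
  map_smul' _ _ := rfl
  invFun p := conformal.mk hC p.1 p.2.1 p.2.2 p.1.2 p.2.1.2 p.2.2.2
  left_inv _ := conformal.ext rfl rfl rfl
  right_inv _ := rfl

section

variable [FiniteDimensional ℂ A]

lemma finrank_hermitian (hC : C.IsComposition) :
    Module.finrank ℂ C.hermitian = 3 + 3 * Module.finrank ℂ A := by
  rw [(hermitianEquiv hC).finrank_eq, Module.finrank_prod, Module.finrank_pi_fintype ℂ,
    Module.finrank_pi_fintype ℂ]
  simp

lemma finrank_conformal (hC : C.IsComposition) :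
    Module.finrank ℂ (C.conformal hC) =
      Module.finrank ℂ C.structureAlgebra + (6 + 6 * Module.finrank ℂ A) := by
  rw [(conformalEquiv hC).finrank_eq, Module.finrank_prod, Module.finrank_prod,
    finrank_hermitian hC]
  ring

lemma finrank_freudenthalSpace (hC : C.IsComposition) :
    Module.finrank ℂ C.FreudenthalSpace = 8 + 6 * Module.finrank ℂ A := by
  change Module.finrank ℂ (ℂ × C.hermitian × C.hermitian × ℂ) = _
  rw [Module.finrank_prod, Module.finrank_prod, Module.finrank_prod, finrank_hermitian hC,
    Module.finrank_self]
  ring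

lemma finrank_blockMatrices (hC : C.IsComposition) :
    Module.finrank ℂ C.blockMatrices =
      Module.finrank ℂ (C.conformal hC) + (9 + 6 * Module.finrank ℂ A) := by
  have : Module.Finite ℂ C.FreudenthalSpace :=
    inferInstanceAs (Module.Finite ℂ (ℂ × C.hermitian × C.hermitian × ℂ))
  have : Module.Finite ℂ (C.conformal hC) := Module.Finite.equiv (conformalEquiv hC).symm
  rw [← (representation hC).finrank_eq]
  change Module.finrank ℂ (C.conformal hC × ℂ × C.FreudenthalSpace) = _
  rw [Module.finrank_prod, Module.finrank_prod, finrank_freudenthalSpace hC, Module.finrank_self]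
  ring

end

/-! ### The representation theorem -/

lemma freudenthalSpace_nontrivial : Nontrivial C.FreudenthalSpace :=
  inferInstanceAs (Nontrivial (ℂ × C.hermitian × C.hermitian × ℂ))

/-- The bracket of block matrices, transported from the intermediate algebra. -/
def blockLie (hC : C.IsComposition) :
    C.blockMatrices →ₗ[ℂ] C.blockMatrices →ₗ[ℂ] C.blockMatrices :=
  LinearMap.mk₂ ℂ
    (fun P Q => representation hC ⁅(representation hC).symm P, (representation hC).symm Q⁆)
    (fun P Q R => by rw [map_add, add_lie, map_add])
    (fun k P Q => by rw [map_smul, smul_lie, map_smul])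
    (fun P Q R => by rw [map_add, lie_add, map_add])
    (fun k P Q => by rw [map_smul, lie_smul, map_smul])

lemma blockLie_apply (hC : C.IsComposition) (P Q : C.blockMatrices) :
    blockLie hC P Q =
      representation hC ⁅(representation hC).symm P, (representation hC).symm Q⁆ := rfl

/-- If `𝔥` is isomorphic to the conformal algebra, then the block matrices represent the
intermediate algebra of `𝔥` and the Freudenthal triple system. -/
theorem representsIntermediate [FiniteDimensional ℂ A] (hC : C.IsComposition)
    {𝔥 : Type} [LieRing 𝔥] [LieAlgebra ℂ 𝔥]
    (e : 𝔥 ≃ₗ⁅ℂ⁆ C.conformal hC) : C.RepresentsIntermediate 𝔥 (8 + 6 * Module.finrank ℂ A)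
      (Module.finrank ℂ (C.conformal hC) + (9 + 6 * Module.finrank ℂ A)) := by
  let i1 : LieRingModule 𝔥 C.FreudenthalSpace :=
    LieRingModule.compLieHom C.FreudenthalSpace e.toLieHom
  let i2 : LieModule ℂ 𝔥 C.FreudenthalSpace := LieModule.compLieHom C.FreudenthalSpace e.toLieHom
  have hlie (x : 𝔥) (v : C.FreudenthalSpace) : ⁅x, v⁆ = ⁅e x, v⁆ := rfl
  let f : Intermediate 𝔥 C.FreudenthalSpace ≃ₗ[ℂ]
      Intermediate (C.conformal hC) C.FreudenthalSpace :=
    e.toLinearEquiv.prodCongr (LinearEquiv.refl ℂ (ℂ × C.FreudenthalSpace))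
  refine ⟨blockLie hC, ?_, ?_, ?_, finrank_blockMatrices hC, C.FreudenthalSpace, inferInstance,
    inferInstance, i1, i2, finrank_freudenthalSpace hC, ?_,
    ⟨FreudenthalSpace.symplecticForm C, FreudenthalSpace.symplecticForm_isAlt,
      FreudenthalSpace.symplecticForm_nondegenerate hC, fun x v w =>
        FreudenthalSpace.symplecticForm_invariant (e x) v w⟩,
    f.trans (representation hC), ?_⟩
  · intro X Y hX hY
    obtain ⟨p, rfl⟩ := exists_blockData hC hX
    obtain ⟨q, rfl⟩ := exists_blockData hC hY
    have h (p : Intermediate (C.conformal hC) C.FreudenthalSpace) (hp) :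
        (representation hC).symm (C.toBlock (blockData p) hp) = p :=
      (representation hC).symm_apply_eq.mpr rfl
    rw [blockLie_apply, h, h, coe_representation, blockBracket_blockData]
  · intro P
    rw [blockLie_apply, lie_self, map_zero]
  · intro P Q R
    simp only [blockLie_apply, LinearEquiv.symm_apply_apply, ← map_add]
    rw [lie_jacobi, map_zero]
  · have := freudenthalSpace_nontrivial (C := C)
    refine LieModule.IsIrreducible.mk fun N hN => ?_
    rw [← LieSubmodule.toSubmodule_eq_top]
    refine FreudenthalSpace.eq_top_of_stable hC
      (fun h => hN ((LieSubmodule.toSubmodule_eq_bot N).mp h)) fun X v hv => ?_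
    have h := N.lie_mem (x := e.symm X) hv
    rw [hlie, e.apply_symm_apply] at h
    exact h
  · intro p q
    rw [blockLie_apply]
    simp only [LinearEquiv.trans_apply, LinearEquiv.symm_apply_apply]
    congr 1
    exact Prod.ext (e.map_lie p.1 q.1) rfl

end Coordinates

open Coordinates

/-! ### The three coordinate algebras -/

lemma realCoordinates_isComposition : realCoordinates.IsComposition where
  conj_mul x y := mul_comm x y
  conj_conj _ := rfl
  add_conj x := by
    simp [realCoordinates]; ring
  re_one := rfl
  re_mul_comm x y := mul_comm x y
  eq_zero_of_re y h := by simpa [realCoordinates] using h 1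

lemma complexCoordinates_re (z : BiComplex) : complexCoordinates.re z = z.re := rfl

lemma complexCoordinates_conj (z : BiComplex) : complexCoordinates.conj z = ⟨z.re, -z.im⟩ := rfl

lemma quaternionCoordinates_re (z : ℍ[ℂ]) : quaternionCoordinates.re z = z.re := rfl

lemma quaternionCoordinates_conj (z : ℍ[ℂ]) : quaternionCoordinates.conj z = star z := rfl

lemma complexCoordinates_isComposition : complexCoordinates.IsComposition where
  conj_mul x y := by
    simp only [complexCoordinates_conj]
    ext <;> simp <;> ring
  conj_conj x := by
    simp only [complexCoordinates_conj]
    ext <;> simp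
  add_conj x := by
    rw [complexCoordinates_conj, complexCoordinates_re, ← Algebra.algebraMap_eq_smul_one,
      QuadraticAlgebra.algebraMap_eq]
    ext
    · simp; ring
    · simp
  re_one := rfl
  re_mul_comm x y := congrArg _ (mul_comm x y)
  eq_zero_of_re y h := by
    simp only [complexCoordinates_re] at h
    ext
    · simpa using h ⟨1, 0⟩
    · simpa using h ⟨0, 1⟩

lemma quaternionCoordinates_isComposition : quaternionCoordinates.IsComposition where
  conj_mul x y := star_mul x y
  conj_conj x := star_star x
  add_conj x := by
    rw [quaternionCoordinates_conj, quaternionCoordinates_re]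
    ext <;> simp ; ring
  re_one := rfl
  re_mul_comm x y := by
    simp only [quaternionCoordinates_re, Quaternion.re_mul]
    ring
  eq_zero_of_re y h := by
    simp only [quaternionCoordinates_re, Quaternion.re_mul] at h
    ext
    · simpa using h 1
    · simpa using h ⟨0, 1, 0, 0⟩
    · simpa using h ⟨0, 0, 1, 0⟩
    · simpa using h ⟨0, 0, 0, 1⟩

/-- Over a commutative algebra there are no commutators, and `sl₃` is given by the trace. -/
lemma mem_specialLinear3_iff {A : Type} [CommRing A] [Algebra ℂ A] {x : Mat3 A} :
    x ∈ specialLinear3 A ↔ x.trace = 0 := by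
  have h : Submodule.span ℂ {c : A | ∃ x y : A, c = x * y - y * x} = ⊥ := by
    rw [Submodule.span_eq_bot]
    rintro _ ⟨x, y, rfl⟩
    rw [mul_comm, sub_self]
  rw [specialLinear3, h, Submodule.mem_comap, Submodule.mem_bot, Matrix.traceLinearMap_apply]

/-! ### Symmetric complex matrices and `c₃` -/

lemma realCoordinates_structureAlgebra : realCoordinates.structureAlgebra = ⊤ := by
  refine eq_top_iff.mpr fun a _ => ?_
  rw [mem_structureAlgebra, mem_specialLinear3_iff, Matrix.trace_sub, Matrix.trace_smul,
    Matrix.trace_one]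
  simp [tr, realCoordinates]
  ring

lemma sp_eq_conformal :
    LieAlgebra.Symplectic.sp (Fin 3) ℂ = conformal realCoordinates_isComposition := by
  have hadj (x : Mat3 ℂ) : realCoordinates.adj x = x.transpose := rfl
  ext X
  obtain ⟨a, b, c, d, rfl⟩ : ∃ a b c d, X = Matrix.fromBlocks a b c d :=
    ⟨_, _, _, _, (Matrix.fromBlocks_toBlocks X).symm⟩
  rw [LieAlgebra.Symplectic.sp, mem_skewAdjointMatricesLieSubalgebra,
    mem_skewAdjointMatricesSubmodule, Matrix.IsSkewAdjoint, Matrix.IsAdjointPair, Matrix.J,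
    Matrix.fromBlocks_transpose, Matrix.fromBlocks_neg, Matrix.fromBlocks_multiply,
    Matrix.fromBlocks_multiply, Matrix.fromBlocks_inj]
  simp only [Matrix.mul_zero, Matrix.mul_one, Matrix.zero_mul, zero_add, add_zero, Matrix.mul_neg,
    neg_mul, one_mul, neg_neg, neg_zero]
  constructor
  · rintro ⟨h1, h2, h3, h4⟩
    refine ⟨a, b, c, ?_, neg_injective h4, h1, ?_⟩
    · rw [realCoordinates_structureAlgebra]
      trivial
    · rw [hadj, h2]
  · rintro ⟨a', b', c', _, hb, hc, h⟩
    obtain ⟨rfl, rfl, rfl, rfl⟩ := Matrix.fromBlocks_inj.mp h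
    refine ⟨hc, rfl, ?_, congrArg Neg.neg hb⟩
    rw [hadj, Matrix.transpose_neg, Matrix.transpose_transpose]

/-- The algebra `c₃` as the conformal algebra of the symmetric matrices. -/
def spEquivConformal : LieAlgebra.Symplectic.sp (Fin 3) ℂ ≃ₗ⁅ℂ⁆
    conformal realCoordinates_isComposition :=
  LieEquiv.ofEq _ _ (congrArg _ sp_eq_conformal)

lemma finrank_conformal_real :
    Module.finrank ℂ (conformal realCoordinates_isComposition) = 21 := by
  rw [finrank_conformal, realCoordinates_structureAlgebra, finrank_top, Module.finrank_matrix,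
    Module.finrank_self, Fintype.card_fin]

/-! ### Hermitian matrices over `ℂ ⊗ ℂ` and `a₅` -/

/-- The projection `x + y u ↦ x + y i` of `ℂ ⊗ ℂ = ℂ × ℂ` to the first factor. -/
def BiComplex.proj : BiComplex →+* ℂ where
  toFun z := z.re + z.im * Complex.I
  map_one' := by
    change (1 : ℂ) + 0 * Complex.I = 1
    simp
  map_zero' := by simp
  map_add' x y := by simp; ring
  map_mul' x y := by
    simp
    linear_combination -(x.im * y.im) * Complex.I_mul_I

/-- The element of `ℂ ⊗ ℂ` with given projections to the two factors. -/
def BiComplex.ofPair (p q : ℂ) : BiComplex := ⟨(p + q) / 2, -(p - q) / 2 * Complex.I⟩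

lemma BiComplex.proj_ofPair (p q : ℂ) : BiComplex.proj (BiComplex.ofPair p q) = p := by
  simp [proj, ofPair]
  linear_combination -(p - q) / 2 * Complex.I_mul_I

lemma BiComplex.conj_ofPair (p q : ℂ) :
    complexCoordinates.conj (BiComplex.ofPair p q) = BiComplex.ofPair q p := by
  ext <;> simp [complexCoordinates, ofPair] <;> ring

lemma BiComplex.ofPair_proj (z : BiComplex) :
    BiComplex.ofPair (proj z) (proj (complexCoordinates.conj z)) = z := by
  ext <;> simp [complexCoordinates, ofPair, proj]
  · ring
  · linear_combination -z.im * Complex.I_mul_I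

lemma complexCoordinates_mem_structureAlgebra {a : Mat3 BiComplex} :
    a ∈ complexCoordinates.structureAlgebra ↔ a.trace.im = 0 := by
  have h3 : (3 : BiComplex) = ⟨3, 0⟩ := rfl
  rw [mem_structureAlgebra, mem_specialLinear3_iff, Matrix.trace_sub, Matrix.trace_smul,
    Matrix.trace_one, QuadraticAlgebra.ext_iff]
  simp [tr, complexCoordinates_re, h3]
  intro _
  ring

open conformal

/-- The first factor of `M₆(ℂ ⊗ ℂ) = M₆(ℂ) × M₆(ℂ)`. -/
def BiComplex.projMatrix : Matrix (Fin 3 ⊕ Fin 3) (Fin 3 ⊕ Fin 3) BiComplex →+*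
    Matrix (Fin 6) (Fin 6) ℂ :=
  (Matrix.reindexAlgEquiv ℂ ℂ (finSumFinEquiv (m := 3) (n := 3))).toRingEquiv.toRingHom.comp
    BiComplex.proj.mapMatrix

lemma BiComplex.projMatrix_smul (k : ℂ) (X : Matrix (Fin 3 ⊕ Fin 3) (Fin 3 ⊕ Fin 3) BiComplex) :
    projMatrix (k • X) = k • projMatrix X := by
  ext i j
  simp [projMatrix, proj]
  ring

lemma BiComplex.trace_projMatrix (X : Matrix (Fin 3 ⊕ Fin 3) (Fin 3 ⊕ Fin 3) BiComplex) :
    (projMatrix X).trace = proj X.trace := by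
  rw [Matrix.trace, Matrix.trace, map_sum]
  exact (finSumFinEquiv (m := 3) (n := 3)).symm.sum_comp fun i => proj (X i i)

lemma trace_fromBlocks_eq_add {R : Type} [AddCommMonoid R] (a b c d : Mat3 R) :
    (Matrix.fromBlocks a b c d).trace = a.trace + d.trace := by
  simp [Matrix.trace]

/-- The projection of the conformal algebra of the Hermitian matrices over `ℂ ⊗ ℂ` to `a₅`. -/
def conformalHomSl : conformal complexCoordinates_isComposition →ₗ⁅ℂ⁆
    LieAlgebra.SpecialLinear.sl (Fin 6) ℂ where
  toFun X := ⟨BiComplex.projMatrix X.1, by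
    have h := complexCoordinates_mem_structureAlgebra.mp (ul_mem X)
    have e : (complexCoordinates.adj (ul X)).trace = complexCoordinates.conj (ul X).trace := by
      simp [adj, Matrix.trace]
    change Matrix.trace (BiComplex.projMatrix X.1) = 0
    rw [BiComplex.trace_projMatrix, coe_eq, trace_fromBlocks_eq_add, Matrix.trace_neg, e]
    simp [BiComplex.proj, complexCoordinates_conj, h]⟩
  map_add' X Y := Subtype.ext (map_add BiComplex.projMatrix X.1 Y.1)
  map_smul' k X := Subtype.ext (BiComplex.projMatrix_smul k X.1)
  map_lie' {X Y} := Subtype.ext (by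
    change BiComplex.projMatrix (X.1 * Y.1 - Y.1 * X.1) = _
    rw [map_sub, map_mul, map_mul]
    rfl)

lemma conformalHomSl_bijective : Function.Bijective conformalHomSl := by
  constructor
  · intro X Y h
    have h' (i j) : BiComplex.proj (X.1 i j) = BiComplex.proj (Y.1 i j) := by
      have h1 := congrFun (congrFun (congrArg Subtype.val h) (finSumFinEquiv i)) (finSumFinEquiv j)
      simpa [conformalHomSl, BiComplex.projMatrix] using h1
    -- a number is determined by the first projections of itself and of its conjugate
    have hz {z w : BiComplex} (h1 : BiComplex.proj z = BiComplex.proj w)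
        (h2 : BiComplex.proj (complexCoordinates.conj z) =
          BiComplex.proj (complexCoordinates.conj w)) : z = w := by
      rw [← BiComplex.ofPair_proj z, h1, h2, BiComplex.ofPair_proj]
    have ha (X : conformal complexCoordinates_isComposition) (i j) :
        complexCoordinates.conj (ul X i j) = -X.1 (Sum.inr j) (Sum.inr i) := by
      rw [coe_eq]
      simp [adj]
    refine conformal.ext ?_ ?_ ?_ <;> ext1 i j
    · refine hz (h' (Sum.inl i) (Sum.inl j)) ?_
      rw [ha, ha, map_neg, map_neg, h']
    · refine hz (h' (Sum.inl i) (Sum.inr j)) ?_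
      have hX : complexCoordinates.conj (ur X i j) = ur X j i :=
        congrFun (congrFun (ur_herm X) j) i
      have hY : complexCoordinates.conj (ur Y i j) = ur Y j i :=
        congrFun (congrFun (ur_herm Y) j) i
      rw [hX, hY]
      exact h' (Sum.inl j) (Sum.inr i)
    · refine hz (h' (Sum.inr i) (Sum.inl j)) ?_
      have hX : complexCoordinates.conj (ll X i j) = ll X j i :=
        congrFun (congrFun (ll_herm X) j) i
      have hY : complexCoordinates.conj (ll Y i j) = ll Y j i :=
        congrFun (congrFun (ll_herm Y) j) i
      rw [hX, hY]
      exact h' (Sum.inr j) (Sum.inl i)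
  · rintro ⟨Z, hZ⟩
    let W : Matrix (Fin 3 ⊕ Fin 3) (Fin 3 ⊕ Fin 3) ℂ := Z.submatrix finSumFinEquiv finSumFinEquiv
    have hW : W.toBlocks₁₁.trace + W.toBlocks₂₂.trace = 0 := by
      rw [← trace_fromBlocks_eq_add, Matrix.fromBlocks_toBlocks]
      exact ((finSumFinEquiv (m := 3) (n := 3)).sum_comp fun i => Z i i).trans hZ
    -- the second projections are forced by the shape of the conformal algebra
    let a : Mat3 BiComplex := Matrix.of fun i j =>
      BiComplex.ofPair (W.toBlocks₁₁ i j) (-W.toBlocks₂₂ j i)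
    let b : Mat3 BiComplex := Matrix.of fun i j =>
      BiComplex.ofPair (W.toBlocks₁₂ i j) (W.toBlocks₁₂ j i)
    let c : Mat3 BiComplex := Matrix.of fun i j =>
      BiComplex.ofPair (W.toBlocks₂₁ i j) (W.toBlocks₂₁ j i)
    have ha : a ∈ complexCoordinates.structureAlgebra := by
      rw [complexCoordinates_mem_structureAlgebra]
      simp only [Matrix.trace, Fin.sum_univ_three, Matrix.diag, Matrix.toBlocks₁₁,
        Matrix.toBlocks₂₂, Matrix.of_apply] at hW
      simp only [Matrix.trace, Fin.sum_univ_three, Matrix.diag, a, Matrix.of_apply,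
        BiComplex.ofPair, QuadraticAlgebra.im_add, Matrix.toBlocks₁₁, Matrix.toBlocks₂₂]
      linear_combination -Complex.I / 2 * hW
    have hb : complexCoordinates.IsHerm b := by
      ext1 i j
      exact BiComplex.conj_ofPair _ _
    have hc : complexCoordinates.IsHerm c := by
      ext1 i j
      exact BiComplex.conj_ofPair _ _
    refine ⟨conformal.mk _ a b c ha hb hc, Subtype.ext ?_⟩
    have key : (Matrix.fromBlocks a b c (-complexCoordinates.adj a)).map BiComplex.proj = W := by
      rw [Matrix.fromBlocks_map, ← Matrix.fromBlocks_toBlocks W]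
      congr 1 <;> ext1 i j
      · exact BiComplex.proj_ofPair _ _
      · exact BiComplex.proj_ofPair _ _
      · exact BiComplex.proj_ofPair _ _
      · change BiComplex.proj (-complexCoordinates.conj (BiComplex.ofPair _ _)) = _
        rw [BiComplex.conj_ofPair, map_neg, BiComplex.proj_ofPair, neg_neg]
    change ((Matrix.fromBlocks a b c (-complexCoordinates.adj a)).map BiComplex.proj).submatrix
      finSumFinEquiv.symm finSumFinEquiv.symm = Z
    rw [key]
    ext1 i j
    simp [W]

lemma finrank_conformal_complex :
    Module.finrank ℂ (conformal complexCoordinates_isComposition) = 35 := by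
  rw [(LinearEquiv.ofBijective conformalHomSl.toLinearMap conformalHomSl_bijective).finrank_eq]
  have h := LinearMap.finrank_range_add_finrank_ker (Matrix.traceLinearMap (Fin 6) ℂ ℂ)
  rw [LinearMap.range_eq_top.mpr (fun c => ⟨Matrix.single 0 0 c, by simp⟩), finrank_top,
    Module.finrank_self, Module.finrank_matrix, Module.finrank_self, Fintype.card_fin] at h
  change Module.finrank ℂ (LinearMap.ker (Matrix.traceLinearMap (Fin 6) ℂ ℂ)) = 35
  omega

/-! ### Hermitian matrices over `ℂ ⊗ ℍ` and `d₆` -/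

/-- Every trace over `ℂ ⊗ ℍ` is a scalar plus a sum of commutators. -/
lemma quaternionCoordinates_structureAlgebra : quaternionCoordinates.structureAlgebra = ⊤ := by
  refine eq_top_iff.mpr fun a _ => ?_
  rw [mem_structureAlgebra]
  have hre : quaternionCoordinates.re (a - (1 / 3 * quaternionCoordinates.tr a) • 1).trace = 0 := by
    change quaternionCoordinates.tr _ = 0
    rw [tr_sub, tr_smul, quaternionCoordinates_isComposition.tr_one]
    ring
  rw [specialLinear3, Submodule.mem_comap, Matrix.traceLinearMap_apply]
  generalize (a - (1 / 3 * quaternionCoordinates.tr a) • 1).trace = z at hre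
  have hre' : z.re = 0 := hre
  -- the three quaternion units
  obtain ⟨i, i0, i1, i2, i3⟩ : ∃ i : ℍ[ℂ], i.re = 0 ∧ i.imI = 1 ∧ i.imJ = 0 ∧ i.imK = 0 :=
    ⟨⟨0, 1, 0, 0⟩, rfl, rfl, rfl, rfl⟩
  obtain ⟨j, j0, j1, j2, j3⟩ : ∃ j : ℍ[ℂ], j.re = 0 ∧ j.imI = 0 ∧ j.imJ = 1 ∧ j.imK = 0 :=
    ⟨⟨0, 0, 1, 0⟩, rfl, rfl, rfl, rfl⟩
  obtain ⟨k, k0, k1, k2, k3⟩ : ∃ k : ℍ[ℂ], k.re = 0 ∧ k.imI = 0 ∧ k.imJ = 0 ∧ k.imK = 1 :=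
    ⟨⟨0, 0, 0, 1⟩, rfl, rfl, rfl, rfl⟩
  have e : z = (z.imI / 2) • (j * k - k * j) + (z.imJ / 2) • (k * i - i * k) +
      (z.imK / 2) • (i * j - j * i) := by
    ext <;> simp [hre', i0, i1, i2, i3, j0, j1, j2, j3, k0, k1, k2, k3] <;> ring
  have hmem (x y : ℍ[ℂ]) (c : ℂ) : c • (x * y - y * x) ∈
      Submodule.span ℂ {c : ℍ[ℂ] | ∃ x y : ℍ[ℂ], c = x * y - y * x} :=
    Submodule.smul_mem _ _ (Submodule.subset_span ⟨x, y, rfl⟩)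
  rw [e]
  exact add_mem (add_mem (hmem _ _ _) (hmem _ _ _)) (hmem _ _ _)

/-- The isomorphism of `ℂ ⊗ ℍ` with the `2 × 2` matrices. -/
def quaternionEquiv : ℍ[ℂ] ≃ₐ[ℂ] Matrix (Fin 2) (Fin 2) ℂ where
  toFun q := !![q.re + q.imI * Complex.I, q.imJ + q.imK * Complex.I;
    -q.imJ + q.imK * Complex.I, q.re - q.imI * Complex.I]
  invFun M := ⟨(M 0 0 + M 1 1) / 2, -(M 0 0 - M 1 1) / 2 * Complex.I, (M 0 1 - M 1 0) / 2,
    -(M 0 1 + M 1 0) / 2 * Complex.I⟩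
  left_inv q := by
    ext <;> simp
    · linear_combination -q.imI * Complex.I_mul_I
    · linear_combination -q.imK * Complex.I_mul_I
  right_inv M := by
    ext i j
    fin_cases i <;> fin_cases j <;> simp
    · linear_combination (-(M 0 0) + M 1 1) / 2 * Complex.I_mul_I
    · linear_combination -(M 0 1 + M 1 0) / 2 * Complex.I_mul_I
    · linear_combination -(M 0 1 + M 1 0) / 2 * Complex.I_mul_I
    · linear_combination ((M 0 0) - M 1 1) / 2 * Complex.I_mul_I
  map_mul' p q := by
    ext i j
    fin_cases i <;> fin_cases j <;>
      simp [Quaternion.re_mul, Quaternion.imI_mul, Quaternion.imJ_mul, Quaternion.imK_mul]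
    · linear_combination -(p.imI * q.imI + p.imK * q.imK) * Complex.I_mul_I
    · linear_combination -(p.imI * q.imK - p.imK * q.imI) * Complex.I_mul_I
    · linear_combination (p.imI * q.imK - p.imK * q.imI) * Complex.I_mul_I
    · linear_combination -(p.imI * q.imI + p.imK * q.imK) * Complex.I_mul_I
  map_add' p q := by
    ext i j
    fin_cases i <;> fin_cases j <;> simp <;> ring
  commutes' c := by
    ext i j
    fin_cases i <;> fin_cases j <;> simp [Matrix.algebraMap_matrix_apply]

lemma quaternionEquiv_apply (q : ℍ[ℂ]) :
    quaternionEquiv q = !![q.re + q.imI * Complex.I, q.imJ + q.imK * Complex.I;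
      -q.imJ + q.imK * Complex.I, q.re - q.imI * Complex.I] := rfl

/-- The quaternion unit `j`; it implements the transposition of `2 × 2` matrices. -/
def unitJ : ℍ[ℂ] := ⟨0, 0, 1, 0⟩

@[simp] lemma unitJ_re : unitJ.re = 0 := rfl
@[simp] lemma unitJ_imI : unitJ.imI = 0 := rfl
@[simp] lemma unitJ_imJ : unitJ.imJ = 1 := rfl
@[simp] lemma unitJ_imK : unitJ.imK = 0 := rfl

lemma unitJ_mul_unitJ : unitJ * unitJ = -1 := by
  ext <;> simp

lemma star_unitJ : star unitJ = -unitJ := by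
  ext <;> simp

lemma quaternionEquiv_transpose (q : ℍ[ℂ]) :
    (quaternionEquiv q).transpose = quaternionEquiv (-(unitJ * star q * unitJ)) := by
  rw [quaternionEquiv_apply, quaternionEquiv_apply]
  ext i j
  fin_cases i <;> fin_cases j <;> simp

/-- The isomorphism of `M₃(ℂ ⊗ ℍ)` with `M₆(ℂ)`. -/
def matrixQuaternionEquiv : Mat3 ℍ[ℂ] ≃ₐ[ℂ] Matrix (Fin 6) (Fin 6) ℂ :=
  (AlgEquiv.mapMatrix quaternionEquiv).trans ((Matrix.compAlgEquiv (Fin 3) (Fin 2) ℂ ℂ).trans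
    (Matrix.reindexAlgEquiv ℂ ℂ (finProdFinEquiv (m := 3) (n := 2))))

/-- The scalar matrix `j`. -/
def matJ : Mat3 ℍ[ℂ] := Matrix.diagonal fun _ => unitJ

lemma matJ_mul_matJ : matJ * matJ = -1 := by
  rw [matJ, Matrix.diagonal_mul_diagonal, unitJ_mul_unitJ, ← Matrix.diagonal_one,
    Matrix.diagonal_neg]

lemma adj_matJ : quaternionCoordinates.adj matJ = -matJ := by
  ext1 i j
  by_cases h : i = j
  · subst h
    simp [adj, matJ, quaternionCoordinates_conj, star_unitJ]
  · simp [adj, matJ, quaternionCoordinates_conj, Matrix.diagonal_apply_ne _ h,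
      Matrix.diagonal_apply_ne _ (Ne.symm h)]

lemma matrixQuaternionEquiv_transpose (x : Mat3 ℍ[ℂ]) :
    (matrixQuaternionEquiv x).transpose =
      matrixQuaternionEquiv (-(matJ * quaternionCoordinates.adj x * matJ)) := by
  ext i j
  obtain ⟨⟨i, k⟩, rfl⟩ := (finProdFinEquiv (m := 3) (n := 2)).surjective i
  obtain ⟨⟨j, l⟩, rfl⟩ := (finProdFinEquiv (m := 3) (n := 2)).surjective j
  have e (y : Mat3 ℍ[ℂ]) (i j k l) : matrixQuaternionEquiv y
      (finProdFinEquiv (m := 3) (n := 2) (i, k)) (finProdFinEquiv (m := 3) (n := 2) (j, l)) =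
      quaternionEquiv (y i j) k l := by
    simp [matrixQuaternionEquiv]
  have h : (-(matJ * quaternionCoordinates.adj x * matJ)) i j =
      -(unitJ * star (x j i) * unitJ) := by
    simp [matJ, adj, quaternionCoordinates_conj]
  rw [Matrix.transpose_apply, e, e, h]
  exact congrFun (congrFun (quaternionEquiv_transpose (x j i)) k) l

section

variable {A : Type} [Ring A] [Algebra ℂ A] {C : Coordinates A} {hC : C.IsComposition}
  {n : Type} [Fintype n] [DecidableEq n] (Φ : Mat3 A ≃ₐ[ℂ] Matrix n n ℂ) (J : Mat3 A)

/-- An element of the conformal algebra, conjugated by `diag(1, J)` and mapped to the complex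
matrices by `Φ`. -/
def toTypeD (X : conformal hC) : Matrix (n ⊕ n) (n ⊕ n) ℂ :=
  Matrix.fromBlocks (Φ (ul X)) (Φ (ur X * J)) (Φ (-(J * ll X))) (-(Φ (ul X)).transpose)

lemma fromBlocks_mem_typeD_iff {n : Type} [Fintype n] [DecidableEq n] {a b c d : Matrix n n ℂ} :
    Matrix.fromBlocks a b c d ∈ LieAlgebra.Orthogonal.typeD n ℂ ↔
      d = -a.transpose ∧ b.transpose = -b ∧ c.transpose = -c := by
  rw [LieAlgebra.Orthogonal.typeD, mem_skewAdjointMatricesLieSubalgebra,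
    mem_skewAdjointMatricesSubmodule, Matrix.IsSkewAdjoint, Matrix.IsAdjointPair,
    LieAlgebra.Orthogonal.JD,
    Matrix.fromBlocks_transpose, Matrix.fromBlocks_neg, Matrix.fromBlocks_multiply,
    Matrix.fromBlocks_multiply, Matrix.fromBlocks_inj]
  simp only [Matrix.mul_zero, Matrix.mul_one, Matrix.zero_mul, Matrix.one_mul, zero_add, add_zero]
  constructor
  · rintro ⟨h1, h2, h3, h4⟩
    exact ⟨by rw [h2, neg_neg], h4, h1⟩
  · rintro ⟨rfl, h2, h3⟩
    exact ⟨h3, (neg_neg _).symm, by simp, h2⟩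

variable {Φ J}

/-- The conjugation turns Hermitian matrices into skew-symmetric ones. -/
lemma toTypeD_mem (hJ : J * J = -1) (hJ' : C.adj J = -J)
    (hΦ : ∀ x, (Φ x).transpose = Φ (-(J * C.adj x * J))) (X : conformal hC) :
    toTypeD Φ J X ∈ LieAlgebra.Orthogonal.typeD n ℂ := by
  have hb : C.adj (ur X) = ur X := ur_herm X
  have hc : C.adj (ll X) = ll X := ll_herm X
  have hJJ (x : Mat3 A) : J * (J * x) = -x := by rw [← mul_assoc, hJ, neg_one_mul]
  refine fromBlocks_mem_typeD_iff.mpr ⟨rfl, ?_, ?_⟩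
  · rw [hΦ, hC.adj_mul, hJ', hb, ← map_neg]
    congr 1
    rw [neg_mul, mul_neg, neg_mul, mul_assoc, mul_assoc, hJJ, neg_neg]
  · rw [hΦ, adj_neg, hC.adj_mul, hJ', hc, ← map_neg]
    congr 1
    rw [mul_neg (ll X), neg_neg, neg_neg, mul_assoc, mul_assoc, hJ, mul_neg_one, mul_neg,
      neg_neg]

lemma toTypeD_lie (hJ : J * J = -1) (hΦ : ∀ x, (Φ x).transpose = Φ (-(J * C.adj x * J)))
    (X Y : conformal hC) :
    toTypeD Φ J ⁅X, Y⁆ = toTypeD Φ J X * toTypeD Φ J Y - toTypeD Φ J Y * toTypeD Φ J X := by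
  have hb : C.adj (ur X) = ur X := ur_herm X
  have hc : C.adj (ll X) = ll X := ll_herm X
  have hb' : C.adj (ur Y) = ur Y := ur_herm Y
  have hc' : C.adj (ll Y) = ll Y := ll_herm Y
  have hJJ (x : Mat3 A) : J * (J * x) = -x := by rw [← mul_assoc, hJ, neg_one_mul]
  simp only [toTypeD]
  rw [Matrix.fromBlocks_multiply, Matrix.fromBlocks_multiply, sub_eq_add_neg,
    Matrix.fromBlocks_neg, Matrix.fromBlocks_add]
  simp only [hΦ, ← map_mul, ← map_neg, ← map_add]
  congr 2 <;>
  simp only [ul_lie, ur_lie, ll_lie, adj_add, adj_sub, hC.adj_mul, hb, hc, hb', hc', mul_add,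
    add_mul, mul_sub, sub_mul, mul_neg, neg_mul, neg_neg, mul_assoc, hJJ] <;>
  abel

variable (Φ J) in
/-- If transposition of complex matrices corresponds to the conjugate transpose followed by the
conjugation with a skew-Hermitian square root of `-1`, then the conformal algebra is an even
orthogonal Lie algebra. -/
def conformalEquivTypeD (hJ : J * J = -1) (hJ' : C.adj J = -J)
    (hΦ : ∀ x, (Φ x).transpose = Φ (-(J * C.adj x * J))) (hs : C.structureAlgebra = ⊤) :
    conformal hC ≃ₗ⁅ℂ⁆ LieAlgebra.Orthogonal.typeD n ℂ :=
  have hJJ (x : Mat3 A) : J * (J * x) = -x := by rw [← mul_assoc, hJ, neg_one_mul]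
  LieEquiv.ofBijective
    { toFun := fun X => ⟨toTypeD Φ J X, toTypeD_mem hJ hJ' hΦ X⟩
      map_add' := fun X Y => Subtype.ext (by
        change toTypeD Φ J (X + Y) = toTypeD Φ J X + toTypeD Φ J Y
        simp only [toTypeD, ul_add, ur_add, ll_add, add_mul, mul_add, neg_add, map_add,
          Matrix.transpose_add, Matrix.fromBlocks_add])
      map_smul' := fun k X => Subtype.ext (by
        change toTypeD Φ J (k • X) = k • toTypeD Φ J X
        simp only [toTypeD, ul_smul, ur_smul, ll_smul, smul_mul_assoc, mul_smul_comm, ← smul_neg,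
          map_smul, Matrix.transpose_smul, Matrix.fromBlocks_smul])
      map_lie' := fun {X Y} => Subtype.ext (toTypeD_lie hJ hΦ X Y) }
    (by
      constructor
      · intro X Y h
        have h' : toTypeD Φ J X = toTypeD Φ J Y := congrArg Subtype.val h
        obtain ⟨h1, h2, h3, -⟩ := Matrix.fromBlocks_inj.mp h'
        have h2' := congrArg (· * J) (Φ.injective h2)
        have h3' := congrArg (J * ·) (Φ.injective h3)
        simp only [mul_assoc, hJ, mul_neg_one, neg_inj] at h2'
        simp only [mul_neg, hJJ, neg_neg] at h3'
        exact conformal.ext (Φ.injective h1) h2' h3'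
      · rintro ⟨Z, hZ⟩
        obtain ⟨a, b, c, d, rfl⟩ : ∃ a b c d, Z = Matrix.fromBlocks a b c d :=
          ⟨_, _, _, _, (Matrix.fromBlocks_toBlocks Z).symm⟩
        obtain ⟨rfl, hb, hc⟩ := fromBlocks_mem_typeD_iff.mp hZ
        obtain ⟨a, rfl⟩ := Φ.surjective a
        obtain ⟨b, rfl⟩ := Φ.surjective b
        obtain ⟨c, rfl⟩ := Φ.surjective c
        rw [hΦ, ← map_neg] at hb hc
        have hb' := neg_injective (Φ.injective hb)
        have hc' := neg_injective (Φ.injective hc)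
        have hb'' : C.IsHerm (-(b * J)) := by
          rw [IsHerm, adj_neg, hC.adj_mul, hJ']
          nth_rw 2 [← hb']
          rw [mul_assoc, mul_assoc, hJ, mul_neg_one, neg_mul, mul_neg]
        have hc'' : C.IsHerm (J * c) := by
          rw [IsHerm, hC.adj_mul, hJ']
          nth_rw 2 [← hc']
          rw [mul_assoc, hJJ, mul_neg]
        refine ⟨conformal.mk _ a (-(b * J)) (J * c) (hs ▸ Submodule.mem_top) hb'' hc'',
          Subtype.ext ?_⟩
        change Matrix.fromBlocks (Φ a) (Φ (-(b * J) * J)) (Φ (-(J * (J * c))))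
          (-(Φ a).transpose) = _
        rw [neg_mul, mul_assoc, hJ, mul_neg_one, neg_neg, hJJ, neg_neg])

end

/-- The isomorphism of the conformal algebra of the Hermitian matrices over `ℂ ⊗ ℍ` with `d₆`. -/
def conformalQuaternionEquiv : conformal quaternionCoordinates_isComposition ≃ₗ⁅ℂ⁆
    LieAlgebra.Orthogonal.typeD (Fin 6) ℂ :=
  conformalEquivTypeD matrixQuaternionEquiv matJ matJ_mul_matJ adj_matJ
    matrixQuaternionEquiv_transpose quaternionCoordinates_structureAlgebra

lemma finrank_conformal_quaternion :
    Module.finrank ℂ (conformal quaternionCoordinates_isComposition) = 66 := by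
  rw [finrank_conformal, quaternionCoordinates_structureAlgebra, finrank_top,
    Module.finrank_matrix, Quaternion.finrank_eq_four, Fintype.card_fin]

end IntermediateLie

end

theorem mainTheorem4 :
    -- `n = 1`: symmetric complex matrices, `c₃` and its `14`-dimensional representation
    IntermediateLie.realCoordinates.RepresentsIntermediate
      (LieAlgebra.Symplectic.sp (Fin 3) ℂ) 14 36 ∧
    -- `n = 2`: `a₅` and its `20`-dimensional representation
    IntermediateLie.complexCoordinates.RepresentsIntermediate
      (LieAlgebra.SpecialLinear.sl (Fin 6) ℂ) 20 56 ∧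
    -- `n = 4`: `d₆` and its `32`-dimensional representation
    IntermediateLie.quaternionCoordinates.RepresentsIntermediate
      (LieAlgebra.Orthogonal.typeD (Fin 6) ℂ) 32 99 := by
  refine ⟨?_, ?_, ?_⟩
  · have h := IntermediateLie.Coordinates.representsIntermediate
      IntermediateLie.realCoordinates_isComposition
      IntermediateLie.spEquivConformal
    rwa [IntermediateLie.finrank_conformal_real, Module.finrank_self] at h
  · have h := IntermediateLie.Coordinates.representsIntermediate
      IntermediateLie.complexCoordinates_isComposition
      (LieEquiv.ofBijective _ IntermediateLie.conformalHomSl_bijective).symm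
    rwa [IntermediateLie.finrank_conformal_complex, QuadraticAlgebra.finrank_eq_two] at h
  · have h := IntermediateLie.Coordinates.representsIntermediate
      IntermediateLie.quaternionCoordinates_isComposition
      IntermediateLie.conformalQuaternionEquiv.symm
    rwa [IntermediateLie.finrank_conformal_quaternion, Quaternion.finrank_eq_four] at h
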